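/- Let $Q>1$, let $\eta\colon[0,\infty)\to[0,\infty)$ be a homeomorphism, and let $a_Z,b_Z,a_W,b_W>0$. Then there exist constants $c,C>0$, depending only on $Q$, $\eta$, $a_Z,b_Z,a_W,b_W$, with the following property. Let $(Z,d_Z,\mu)$ and $(W,d_W,\nu)$ be compact, connected metric spaces with Borel measures that are Ahlfors $Q$-regular with constants $(a_Z,b_Z)$ and $(a_W,b_W)$ respectively; that is, $a_Z r^Q\le\mu(B(z,r))\le b_Z r^Q$ for all $z\in Z$ and $0<r\le\operatorname{diam}Z$, and $a_W r^Q\le\nu(B(w,r))\le b_W r^Q$ for all $w\in W$ and $0<r\le\operatorname{diam}W$. Let $\varphi\colon Z\to W$ be an $\eta$-quasisymmetric homeomorphism, i.e. a homeomorphism such that for all $z,z',z''\in Z$ and $t\ge 0$, $d_Z(z,z')\le t\,d_Z(z,z'')$ implies $d_W(\varphi(z),\varphi(z'))\le\eta(t)\,d_W(\varphi(z),\varphi(z''))$. Then for every family $\Gamma$ of paths in $Z$ (continuous maps $\gamma\colon I\to Z$, $I\subseteq\mathbb R$ a nonempty interval, possibly varying with $\gamma$), $$c\,\mathrm{Mod}_Q(\Gamma)\le\mathrm{Mod}_Q(\varphi(\Gamma))\le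 C\,\mathrm{Mod}_Q(\Gamma),$$ where $\varphi(\Gamma)=\{\varphi\circ\gamma:\gamma\in\Gamma\}$. Here $\mathrm{Mod}_Q(\Gamma)\in[0,\infty]$ is the infimum of $\int_Z\rho^Q\,d\mu$ over all Borel functions $\rho\colon Z\to[0,\infty]$ with $\int_\gamma\rho\,ds\ge 1$ for every rectifiable $\gamma\in\Gamma$, where $\int_\gamma\rho\,ds$ is the integral with respect to arclength and the infimum of the empty set is $\infty$; $\mathrm{Mod}_Q(\varphi(\Gamma))$ is defined in the same way with respect to $d_W$ and $\nu$. -/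

import Mathlib

open Set MeasureTheory
open scoped NNReal ENNReal

noncomputable section

/-- A path in `Z`: a continuous map from a (nonempty) interval of `ℝ`, of any kind, into `Z`. -/
structure IntervalPath (Z : Type*) [TopologicalSpace Z] where
  domain : Set ℝ
  ordConnected : domain.OrdConnected
  nonempty : domain.Nonempty
  toFun : domain → Z
  continuous_toFun : Continuous toFun

namespace IntervalPath

/-- The image `φ ∘ γ` of a path under a continuous map. -/
def map {Z W : Type*} [TopologicalSpace Z] [TopologicalSpace W] (φ : C(Z, W))
    (γ : IntervalPath Z) : IntervalPath W where
  domain := γ.domain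
  ordConnected := γ.ordConnected
  nonempty := γ.nonempty
  toFun := φ ∘ γ.toFun
  continuous_toFun := φ.continuous.comp γ.continuous_toFun

variable {Z : Type*} [MetricSpace Z]

/-- The length of a path: the supremum of `∑ d(γ(tᵢ), γ(tᵢ₊₁))` over all partitions. -/
def length (γ : IntervalPath Z) : ℝ≥0∞ := eVariationOn γ.toFun univ

/-- A path is rectifiable if its length is finite. -/
def Rectifiable (γ : IntervalPath Z) : Prop := γ.length < ∞

/-- A base point from which the arclength is measured; path integrals do not depend on it. -/
def basePoint (γ : IntervalPath Z) : γ.domain := ⟨γ.nonempty.some, γ.nonempty.some_mem⟩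

/-- The interval on which the arclength parameterization of a rectifiable path is defined: the
set of all signed lengths of `γ` between the base point and another point of the domain. -/
def arclengthDomain (γ : IntervalPath Z) : Set ℝ :=
  range (variationOnFromTo γ.toFun univ γ.basePoint)

/-- The arclength parameterization of a rectifiable path. -/
def arclengthParam (γ : IntervalPath Z) : ℝ → Z :=
  naturalParameterization γ.toFun univ γ.basePoint

/-- The integral of `ρ` along a rectifiable path, with respect to the arclength
parameterization. -/
def integral (γ : IntervalPath Z) (ρ : Z → ℝ≥0∞) : ℝ≥0∞ :=
  ∫⁻ t in γ.arclengthDomain, ρ (γ.arclengthParam t)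

end IntervalPath

/-- A Borel function `ρ : Z → [0, ∞]` is admissible for the path family `Γ` if its integral along
every rectifiable path of `Γ` is at least `1`. -/
def AdmissibleFor {Z : Type*} [MetricSpace Z] [MeasurableSpace Z]
    (ρ : Z → ℝ≥0∞) (Γ : Set (IntervalPath Z)) : Prop :=
  Measurable ρ ∧ ∀ γ ∈ Γ, γ.Rectifiable → 1 ≤ γ.integral ρ

/-- The `p`-modulus of a path family: the infimum of `∫ ρ ^ p dμ` over all admissible `ρ`. -/
def pathModulus {Z : Type*} [MetricSpace Z] [MeasurableSpace Z] (μ : Measure Z) (p : ℝ)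
    (Γ : Set (IntervalPath Z)) : ℝ≥0∞ :=
  ⨅ (ρ : Z → ℝ≥0∞) (_ : AdmissibleFor ρ Γ), ∫⁻ z, ρ z ^ p ∂μ

/-- Ahlfors `Q`-regularity with constants `a` and `b`:
`a r ^ Q ≤ μ(B(z, r)) ≤ b r ^ Q` for all `z` and all `0 < r ≤ diam Z`. -/
def AhlforsRegular {Z : Type*} [MetricSpace Z] [MeasurableSpace Z] (μ : Measure Z)
    (Q a b : ℝ) : Prop :=
  ∀ (z : Z) (r : ℝ), 0 < r → r ≤ Metric.diam (univ : Set Z) →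
    ENNReal.ofReal (a * r ^ Q) ≤ μ (Metric.ball z r) ∧
      μ (Metric.ball z r) ≤ ENNReal.ofReal (b * r ^ Q)

/-- `φ` is `η`-quasisymmetric: `|z - z'| ≤ t |z - z''|` implies
`|φ z - φ z'| ≤ η(t) |φ z - φ z''|`. -/
def IsQuasisymmetric {Z W : Type*} [MetricSpace Z] [MetricSpace W] (η : ℝ≥0 → ℝ≥0)
    (φ : Z → W) : Prop :=
  ∀ (z z' z'' : Z) (t : ℝ≥0), dist z z' ≤ t * dist z z'' →
    dist (φ z) (φ z') ≤ η t * dist (φ z) (φ z'')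

end

noncomputable section

open Filter Topology

/-! ### Arclength as a measure on the domain of a path -/

namespace IntervalPath

variable {Z : Type*} [MetricSpace Z]

/-! Everything reduces to a one-sided bound `pathModulus_le_modulusConst_mul`: Mod(Γ) ≤ C Mod(φ(Γ))
for a weakly quasisymmetric φ. Both φ and its inverse are weakly quasisymmetric, with constants read
off from η, so applying the bound to each gives both inequalities. No differentiability or absolute
continuity of φ is needed, because densities are pulled back only at discrete scales.

Given ρ admissible for φ(Γ), first make it lower semicontinuous and bounded below by a positive
constant (`exists_lowerSemicontinuous_ge`). At scale ε cover Z by balls B(i, ε) centred at a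
separated net, let R_i be the outer radius of φ(B(i, ε)), and put the weight (inf of ρ over φ(B(i,
ε))) · R_i / ε on B(i, 2ε). Call the sum σ. By bounded overlap and regularity, the energy of σ is at
most a constant times ∑ (inf ρ)^Q R_i^Q. Quasisymmetry puts a ball of radius comparable to R_i
inside φ(B(i, ε/2)), and these sets are disjoint, so the sum is controlled by ∫ ρ^Q
(`exists_discretization`). A subarc of diameter at least 2ε that meets B(i, ε) spends length at
least ε in B(i, 2ε), so the integral of σ bounds the displacement of the image path from below.

As ε → 0, superadditivity of lower limits and lower semicontinuity of ρ give ∫_{φ∘γ} ρ ≤ 2 liminf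
∫_γ σ_n. When φ∘γ is not rectifiable, the lower bound on ρ makes the right side infinite. So every
rectifiable γ in Γ satisfies ∫_γ σ_n ≥ 1/4 for all large n, but how large depends on γ.

The families Γ_k on which this holds from index k on increase to Γ and have uniformly bounded
modulus. That this bounds the modulus of the union (`pathModulus_iUnion_le`) is where Q > 1 enters:
by uniform convexity, almost minimizers for Γ_k are Cauchy in L^Q, and a fast subsequence has a
common majorant of controlled energy. -/

instance instOrdConnectedDomain (γ : IntervalPath Z) : γ.domain.OrdConnected := γ.ordConnected

/-- The signed length of a path between the base point and another point of its domain. -/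
def arclength (γ : IntervalPath Z) : γ.domain → ℝ :=
  variationOnFromTo γ.toFun univ γ.basePoint

/-- A right inverse of the arclength function of a path. -/
def arclengthInv (γ : IntervalPath Z) : ℝ → γ.domain :=
  @Function.invFunOn _ _ ⟨γ.basePoint⟩ γ.arclength univ

/-- The arclength measure of a path, as a measure on its domain. -/
def arclengthMeasure (γ : IntervalPath Z) : Measure γ.domain :=
  (volume.restrict γ.arclengthDomain).map γ.arclengthInv

variable {γ : IntervalPath Z}

theorem Rectifiable.locallyBoundedVariationOn (h : γ.Rectifiable) :
    LocallyBoundedVariationOn γ.toFun univ :=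
  BoundedVariationOn.locallyBoundedVariationOn (f := γ.toFun) (s := univ) h.ne

theorem Rectifiable.monotone_arclength (h : γ.Rectifiable) : Monotone γ.arclength :=
  monotoneOn_univ.1 (variationOnFromTo.monotoneOn h.locallyBoundedVariationOn (mem_univ _))

theorem Rectifiable.ofReal_arclength_sub (h : γ.Rectifiable) {x y : γ.domain} (hxy : x ≤ y) :
    ENNReal.ofReal (γ.arclength y - γ.arclength x) = eVariationOn γ.toFun (Icc x y) := by
  rw [arclength, variationOnFromTo.sub_right h.locallyBoundedVariationOn (mem_univ _) (mem_univ _)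
    (mem_univ _), variationOnFromTo.eq_of_le _ _ hxy, univ_inter, ENNReal.ofReal_toReal]
  exact ((eVariationOn.mono _ (subset_univ _)).trans_lt h).ne

theorem Rectifiable.dist_le (h : γ.Rectifiable) (x y : γ.domain) :
    dist (γ.toFun x) (γ.toFun y) ≤ |γ.arclength x - γ.arclength y| := by
  wlog hxy : x ≤ y generalizing x y
  · rw [dist_comm, abs_sub_comm]
    exact this y x (le_of_not_ge hxy)
  rw [abs_sub_comm, abs_of_nonneg (sub_nonneg.2 (h.monotone_arclength hxy)),
    ← ENNReal.ofReal_le_ofReal_iff (sub_nonneg.2 (h.monotone_arclength hxy)),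
    h.ofReal_arclength_sub hxy, ← edist_dist]
  exact eVariationOn.edist_le _ (left_mem_Icc.2 hxy) (right_mem_Icc.2 hxy)

/-- The one-sided jumps of the variation function are those of the path itself, and a continuous
path has none. -/
theorem Rectifiable.continuous_arclength (h : γ.Rectifiable) : Continuous γ.arclength := by
  rw [continuous_iff_continuousAt]
  intro x
  have hl := variationOnFromTo.tendsto_left (a := γ.basePoint) (b := x) (mem_univ _) (mem_univ _)
    h.locallyBoundedVariationOn
    ((γ.continuous_toFun.tendsto x).mono_left nhdsWithin_le_nhds)
  have hr := variationOnFromTo.tendsto_right (a := γ.basePoint) (b := x) (mem_univ _) (mem_univ _)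
    h.locallyBoundedVariationOn
    ((γ.continuous_toFun.tendsto x).mono_left nhdsWithin_le_nhds)
  simp only [univ_inter, dist_self, sub_zero, add_zero] at hl hr
  exact continuousAt_iff_continuous_left'_right'.2 ⟨hl, hr⟩

theorem isPreconnected_of_ordConnected {K : Set γ.domain} (hK : K.OrdConnected) :
    IsPreconnected K := by
  rw [← Topology.IsInducing.subtypeVal.isPreconnected_image, isPreconnected_iff_ordConnected]
  refine ordConnected_def.2 ?_
  rintro _ ⟨x, hx, rfl⟩ _ ⟨y, hy, rfl⟩ t ht
  exact ⟨⟨t, γ.ordConnected.out x.2 y.2 ht⟩, hK.out hx hy ⟨ht.1, ht.2⟩, rfl⟩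

theorem Rectifiable.ordConnected_arclengthDomain (h : γ.Rectifiable) :
    γ.arclengthDomain.OrdConnected := by
  rw [← isPreconnected_iff_ordConnected, arclengthDomain, ← image_univ]
  exact (isPreconnected_of_ordConnected ordConnected_univ).image _
    h.continuous_arclength.continuousOn

theorem arclength_arclengthInv {s : ℝ} (hs : s ∈ γ.arclengthDomain) :
    γ.arclength (γ.arclengthInv s) = s := by
  obtain ⟨x, hx⟩ := hs
  exact @Function.invFunOn_eq _ _ univ γ.arclength s ⟨γ.basePoint⟩ ⟨x, mem_univ _, hx⟩

theorem Rectifiable.aemeasurable_arclengthInv (h : γ.Rectifiable) :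
    AEMeasurable γ.arclengthInv (volume.restrict γ.arclengthDomain) := by
  refine aemeasurable_restrict_of_monotoneOn h.ordConnected_arclengthDomain.measurableSet ?_
  intro s hs t ht hst
  by_contra! hlt
  have := h.monotone_arclength hlt.le
  rw [arclength_arclengthInv hs, arclength_arclengthInv ht] at this
  rw [le_antisymm hst this] at hlt
  exact hlt.false

/-- Transporting the integral to the domain of the path lets subarcs be handled as order-convex sets
of parameters, shared by γ and φ ∘ γ. -/
theorem Rectifiable.integral_eq [MeasurableSpace Z] [BorelSpace Z] (h : γ.Rectifiable)
    {ρ : Z → ℝ≥0∞} (hρ : Measurable ρ) :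
    γ.integral ρ = ∫⁻ t, ρ (γ.toFun t) ∂γ.arclengthMeasure := by
  have := lintegral_map' (hρ.comp γ.continuous_toFun.measurable).aemeasurable
    h.aemeasurable_arclengthInv
  exact this.symm

theorem Rectifiable.arclengthMeasure_apply (h : γ.Rectifiable) {K : Set γ.domain}
    (hK : MeasurableSet K) :
    γ.arclengthMeasure K = volume (γ.arclengthInv ⁻¹' K ∩ γ.arclengthDomain) := by
  rw [arclengthMeasure, Measure.map_apply_of_aemeasurable h.aemeasurable_arclengthInv hK,
    Measure.restrict_apply' h.ordConnected_arclengthDomain.measurableSet]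

/-- Two arclength values coming from K differ by a variation over a subinterval of K, and Lebesgue
measure on the line is at most the diameter. -/
theorem Rectifiable.arclengthMeasure_le (h : γ.Rectifiable) {K : Set γ.domain}
    (hK : K.OrdConnected) : γ.arclengthMeasure K ≤ eVariationOn γ.toFun K := by
  rw [h.arclengthMeasure_apply hK.measurableSet]
  refine (Real.volume_le_diam _).trans (Metric.ediam_le ?_)
  intro s hs t ht
  wlog hst : γ.arclengthInv s ≤ γ.arclengthInv t generalizing s t
  · rw [edist_comm]
    exact this t ht s hs (le_of_not_ge hst)
  have := h.monotone_arclength hst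
  calc edist s t = ENNReal.ofReal (γ.arclength (γ.arclengthInv t) -
        γ.arclength (γ.arclengthInv s)) := by
        rw [edist_comm, edist_dist, Real.dist_eq, ← arclength_arclengthInv hs.2,
          ← arclength_arclengthInv ht.2, abs_of_nonneg]
        · simp only [arclength_arclengthInv hs.2, arclength_arclengthInv ht.2]
        · simpa using this
    _ ≤ eVariationOn γ.toFun K := by
        rw [h.ofReal_arclength_sub hst]
        exact eVariationOn.mono _ (hK.out hs.1 ht.1)

theorem Rectifiable.arclengthMeasure_singleton (h : γ.Rectifiable) (x : γ.domain) :
    γ.arclengthMeasure {x} = 0 := by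
  have := h.arclengthMeasure_le (ordConnected_singleton (a := x))
  rwa [eVariationOn.subsingleton _ subsingleton_singleton, nonpos_iff_eq_zero] at this

/-- Arclength dominates distance: the arclength interval of length ε issuing from x towards y ends
before y, hence stays in K, and its points remain within ε of x. -/
theorem Rectifiable.le_arclengthMeasure_inter_ball (h : γ.Rectifiable) {K : Set γ.domain}
    (hK : K.OrdConnected) {x y : γ.domain} (hx : x ∈ K) (hy : y ∈ K) {ε : ℝ}
    (hε : ε ≤ dist (γ.toFun x) (γ.toFun y)) :
    ENNReal.ofReal ε ≤ γ.arclengthMeasure (K ∩ {t | dist (γ.toFun t) (γ.toFun x) < ε}) := by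
  have hm : MeasurableSet (K ∩ {t | dist (γ.toFun t) (γ.toFun x) < ε}) :=
    hK.measurableSet.inter
      (isOpen_lt (γ.continuous_toFun.dist continuous_const) continuous_const).measurableSet
  have hd := hε.trans (h.dist_le x y)
  rw [h.arclengthMeasure_apply hm]
  rcases le_total x y with hxy | hxy
  · rw [abs_sub_comm, abs_of_nonneg (sub_nonneg.2 (h.monotone_arclength hxy))] at hd
    calc ENNReal.ofReal ε = volume (Ioo (γ.arclength x) (γ.arclength x + ε)) := by simp
      _ ≤ _ := by
        refine measure_mono fun s hs => ?_
        have hsJ : s ∈ γ.arclengthDomain :=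
          h.ordConnected_arclengthDomain.out ⟨x, rfl⟩ ⟨y, rfl⟩ ⟨hs.1.le, by
            change s ≤ γ.arclength y; linarith [hs.2]⟩
        have e := arclength_arclengthInv hsJ
        refine ⟨⟨hK.out hx hy ⟨?_, ?_⟩, ?_⟩, hsJ⟩
        · by_contra! hlt
          have := h.monotone_arclength hlt.le
          linarith [hs.1]
        · by_contra! hlt
          have := h.monotone_arclength hlt.le
          linarith [hs.2]
        · refine (h.dist_le _ _).trans_lt ?_
          rw [e, abs_lt]
          constructor <;> linarith [hs.1, hs.2]
  · rw [abs_of_nonneg (sub_nonneg.2 (h.monotone_arclength hxy))] at hd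
    calc ENNReal.ofReal ε = volume (Ioo (γ.arclength x - ε) (γ.arclength x)) := by simp
      _ ≤ _ := by
        refine measure_mono fun s hs => ?_
        have hsJ : s ∈ γ.arclengthDomain :=
          h.ordConnected_arclengthDomain.out ⟨y, rfl⟩ ⟨x, rfl⟩ ⟨by
            change γ.arclength y ≤ s; linarith [hs.1], hs.2.le⟩
        have e := arclength_arclengthInv hsJ
        refine ⟨⟨hK.out hy hx ⟨?_, ?_⟩, ?_⟩, hsJ⟩
        · by_contra! hlt
          have := h.monotone_arclength hlt.le
          linarith [hs.1]
        · by_contra! hlt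
          have := h.monotone_arclength hlt.le
          linarith [hs.2]
        · refine (h.dist_le _ _).trans_lt ?_
          rw [e, abs_lt]
          constructor <;> linarith [hs.1, hs.2]

end IntervalPath

/-! ### Uniform convexity and series estimates -/

/-- A quantitative form of the strict convexity of `x ↦ x ^ Q`. -/
theorem exists_midpoint_rpow_add_le_real {Q : ℝ} (hQ : 1 < Q) {τ : ℝ} (hτ : 0 < τ) :
    ∃ δ : ℝ, 0 < δ ∧ ∀ a b : ℝ, 0 ≤ a → 0 ≤ b → τ * b ≤ b - a →
      ((a + b) / 2) ^ Q + δ * b ^ Q ≤ (a ^ Q + b ^ Q) / 2 := by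
  have hQ0 : 0 ≤ Q := by linarith
  -- For τ > 1 the hypothesis forces a = b = 0, and the interval [0, 1 - τ] used below would be
  -- empty.
  obtain hτ1 | hτ1 := lt_or_ge 1 τ
  · refine ⟨1, one_pos, fun a b ha hb hab => ?_⟩
    have hb0 : b = 0 := by nlinarith
    have ha0 : a = 0 := by nlinarith
    subst hb0 ha0
    simp [Real.zero_rpow (by linarith : Q ≠ 0)]
  -- By homogeneity only s = a / b matters. F is the convexity gap, positive away from s = 1, and
  -- its minimum on the compact interval serves as δ.
  let F : ℝ → ℝ := fun s => (s ^ Q + 1) / 2 - ((s + 1) / 2) ^ Q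
  have hF : ContinuousOn F (Icc 0 (1 - τ)) := by
    have h1 := Real.continuous_rpow_const hQ0
    have h2 : Continuous fun s : ℝ => ((s + 1) / 2) ^ Q := h1.comp (by fun_prop)
    exact (((h1.add continuous_const).div_const 2).sub h2).continuousOn
  obtain ⟨s₀, hs₀, hmin⟩ := isCompact_Icc.exists_isMinOn
    (nonempty_Icc.2 (by linarith : (0 : ℝ) ≤ 1 - τ)) hF
  have hpos : 0 < F s₀ := by
    have := (strictConvexOn_rpow hQ).2 (mem_Ici.2 hs₀.1) (mem_Ici.2 zero_le_one)
      (by linarith [hs₀.2] : s₀ ≠ 1) (by norm_num : (0 : ℝ) < 1 / 2)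
      (by norm_num : (0 : ℝ) < 1 / 2) (by norm_num)
    simp only [smul_eq_mul, Real.one_rpow] at this
    have e : (1 / 2 * s₀ + 1 / 2 * 1 : ℝ) = (s₀ + 1) / 2 := by ring
    rw [e] at this
    simp only [F]
    linarith
  refine ⟨F s₀, hpos, fun a b ha hb hab => ?_⟩
  rcases hb.eq_or_lt with rfl | hb
  · have ha0 : a = 0 := by nlinarith
    subst ha0
    simp [Real.zero_rpow (by linarith : Q ≠ 0)]
  have hab' : a / b ∈ Icc 0 (1 - τ) := ⟨by positivity, by
    rw [div_le_iff₀ hb]; linarith⟩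
  have h := isMinOn_iff.1 hmin _ hab'
  have e1 : a ^ Q = (a / b) ^ Q * b ^ Q := by
    rw [← Real.mul_rpow (by positivity) hb.le, div_mul_cancel₀ _ hb.ne']
  have e2 : ((a + b) / 2) ^ Q = ((a / b + 1) / 2) ^ Q * b ^ Q := by
    rw [← Real.mul_rpow (by positivity) hb.le]
    congr 1
    field_simp
  have hbQ : 0 < b ^ Q := Real.rpow_pos_of_pos hb Q
  rw [e1, e2]
  have : F s₀ * b ^ Q ≤ F (a / b) * b ^ Q := mul_le_mul_of_nonneg_right h hbQ.le
  have e3 : F (a / b) * b ^ Q =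
      ((a / b) ^ Q * b ^ Q + b ^ Q) / 2 - ((a / b + 1) / 2) ^ Q * b ^ Q := by
    simp only [F]; ring
  linarith

/-- A quantitative form of the strict convexity of `x ↦ x ^ Q` on `[0, ∞]`. -/
theorem exists_midpoint_rpow_add_le {Q : ℝ} (hQ : 1 < Q) {τ : ℝ≥0} (hτ : 0 < τ) :
    ∃ δ : ℝ≥0, 0 < δ ∧ ∀ a b : ℝ≥0∞,
      (2⁻¹ * a + 2⁻¹ * b) ^ Q + δ * (b - a) ^ Q ≤
        2⁻¹ * a ^ Q + 2⁻¹ * b ^ Q + δ * (τ * b) ^ Q := by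
  obtain ⟨δ, hδ, H⟩ := exists_midpoint_rpow_add_le_real hQ (τ := τ) hτ
  have hQ0 : 0 ≤ Q := by linarith
  have hQ1 : 0 < Q := by linarith
  refine ⟨δ.toNNReal, Real.toNNReal_pos.2 hδ, fun a b => ?_⟩
  by_cases hb : b = ∞
  · simp [hb, ENNReal.top_rpow_of_pos hQ1]
  by_cases ha : a = ∞
  · simp [ha, ENNReal.top_rpow_of_pos hQ1]
  -- If b - a is small, plain convexity suffices and the term with τ absorbs the rest; otherwise the
  -- real estimate applies, with (b - a)^Q ≤ b^Q.
  rcases le_or_gt (b - a) (τ * b) with hab | hab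
  · refine add_le_add (ENNReal.rpow_arith_mean_le_arith_mean2_rpow _ _ _ _
      ENNReal.inv_two_add_inv_two hQ.le) ?_
    gcongr
  · refine le_add_right ?_
    lift a to ℝ≥0 using ha
    lift b to ℝ≥0 using hb
    have h1 : (b - a : ℝ≥0∞) ^ Q ≤ (b : ℝ≥0∞) ^ Q := by
      gcongr
      exact tsub_le_self
    refine (add_le_add le_rfl (mul_le_mul_right h1 _)).trans ?_
    have hab' : τ * b < b - a := by exact_mod_cast hab
    have h2 : (τ * b : ℝ) ≤ b - a := by
      rw [← NNReal.coe_sub (tsub_pos_iff_lt.1 (pos_of_gt hab')).le]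
      exact_mod_cast hab'.le
    have := H a b a.2 b.2 h2
    have e : (2⁻¹ : ℝ≥0∞) = ((2⁻¹ : ℝ≥0) : ℝ≥0∞) := by simp
    rw [e]
    simp only [← ENNReal.coe_mul, ← ENNReal.coe_add, ← ENNReal.coe_rpow_of_nonneg _ hQ0]
    rw [ENNReal.coe_le_coe, ← NNReal.coe_le_coe]
    push_cast
    rw [Real.coe_toNNReal _ hδ.le]
    convert this using 2 <;> ring_nf

/-- A weighted form of Hölder's inequality for series. -/
theorem ENNReal.tsum_rpow_le {Q : ℝ} (hQ : 0 < Q) (d : ℕ → ℝ≥0∞) :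
    (∑' j, d j) ^ Q ≤ 2 ^ Q * ∑' j, (2 ^ j) ^ Q * d j ^ Q := by
  set S := ∑' j, ((2 : ℝ≥0∞) ^ j) ^ Q * d j ^ Q with hS
  have h1 : ∀ j, d j ≤ 2⁻¹ ^ j * S ^ (1 / Q) := by
    intro j
    have : (2 ^ j) * d j ≤ S ^ (1 / Q) := by
      rw [one_div, ENNReal.le_rpow_inv_iff hQ, ENNReal.mul_rpow_of_nonneg _ _ hQ.le]
      exact ENNReal.le_tsum (f := fun j => ((2 : ℝ≥0∞) ^ j) ^ Q * d j ^ Q) j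
    calc d j = 2⁻¹ ^ j * (2 ^ j * d j) := by
          rw [← mul_assoc, ← mul_pow, ENNReal.inv_mul_cancel (by simp) (by simp), one_pow, one_mul]
      _ ≤ _ := by gcongr
  calc (∑' j, d j) ^ Q ≤ (∑' j, 2⁻¹ ^ j * S ^ (1 / Q)) ^ Q := by
        gcongr with j; exact h1 j
    _ = (2 * S ^ (1 / Q)) ^ Q := by
        rw [ENNReal.tsum_mul_right, ENNReal.tsum_geometric, ENNReal.one_sub_inv_two, inv_inv]
    _ = 2 ^ Q * S := by
        rw [ENNReal.mul_rpow_of_nonneg _ _ hQ.le, ← ENNReal.rpow_mul,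
          one_div_mul_cancel hQ.ne', ENNReal.rpow_one]

/-! ### Modulus of increasing unions of path families -/

section Modulus

variable {Z : Type*} [MetricSpace Z] [MeasurableSpace Z] {μ : Measure Z} {Q : ℝ}

theorem AdmissibleFor.mono {ρ ρ' : Z → ℝ≥0∞} {Γ : Set (IntervalPath Z)} (h : AdmissibleFor ρ Γ)
    (hρ' : Measurable ρ') (hle : ρ ≤ ρ') : AdmissibleFor ρ' Γ :=
  ⟨hρ', fun γ hγ hr => (h.2 γ hγ hr).trans (lintegral_mono fun _ => hle _)⟩

theorem AdmissibleFor.subset {ρ : Z → ℝ≥0∞} {Γ Γ' : Set (IntervalPath Z)}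
    (h : AdmissibleFor ρ Γ) (hΓ : Γ' ⊆ Γ) : AdmissibleFor ρ Γ' :=
  ⟨h.1, fun γ hγ => h.2 γ (hΓ hγ)⟩

theorem pathModulus_mono {Γ Γ' : Set (IntervalPath Z)} (hΓ : Γ' ⊆ Γ) :
    pathModulus μ Q Γ' ≤ pathModulus μ Q Γ :=
  le_iInf₂ fun ρ h => iInf₂_le ρ (h.subset hΓ)

theorem AdmissibleFor.pathModulus_le {ρ : Z → ℝ≥0∞} {Γ : Set (IntervalPath Z)}
    (h : AdmissibleFor ρ Γ) : pathModulus μ Q Γ ≤ ∫⁻ z, ρ z ^ Q ∂μ := iInf₂_le ρ h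

theorem AdmissibleFor.midpoint {ρ ρ' : Z → ℝ≥0∞} {Γ : Set (IntervalPath Z)}
    (h : AdmissibleFor ρ Γ) (h' : AdmissibleFor ρ' Γ) :
    AdmissibleFor (fun z => 2⁻¹ * ρ z + 2⁻¹ * ρ' z) Γ := by
  refine ⟨(h.1.const_mul _).add (h'.1.const_mul _), fun γ hγ hr => ?_⟩
  calc (1 : ℝ≥0∞) = 2⁻¹ * 1 + 2⁻¹ * 1 := by simp [ENNReal.inv_two_add_inv_two]
    _ ≤ 2⁻¹ * γ.integral ρ + 2⁻¹ * γ.integral ρ' := by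
        gcongr
        · exact h.2 γ hγ hr
        · exact h'.2 γ hγ hr
    _ ≤ _ := by
        unfold IntervalPath.integral
        rw [← lintegral_const_mul' _ _ (by simp), ← lintegral_const_mul' _ _ (by simp)]
        exact le_lintegral_add _ _

theorem exists_admissibleFor_lt {Γ : Set (IntervalPath Z)} {M : ℝ≥0∞}
    (h : pathModulus μ Q Γ < M) : ∃ ρ, AdmissibleFor ρ Γ ∧ ∫⁻ z, ρ z ^ Q ∂μ < M := by
  simpa only [pathModulus, iInf_lt_iff, exists_prop] using h

/-- Almost minimizers for an increasing sequence of path families of bounded modulus form a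
Cauchy sequence in `L ^ Q`. -/
theorem exists_forall_lintegral_sub_rpow_le (hQ : 1 < Q) {Γ : ℕ → Set (IntervalPath Z)}
    (hΓ : Monotone Γ) {M : ℝ≥0∞} (hM : M ≠ ∞) (h : ∀ k, pathModulus μ Q (Γ k) ≤ M)
    {ρ : ℕ → Z → ℝ≥0∞} (hρ : ∀ k, AdmissibleFor (ρ k) (Γ k)) {e : ℕ → ℝ≥0∞}
    (he : Tendsto e atTop (𝓝 0)) (heanti : Antitone e) (heM : ∀ k, e k ≤ M)
    (hle : ∀ k, ∫⁻ z, ρ k z ^ Q ∂μ ≤ pathModulus μ Q (Γ k) + e k)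
    {θ : ℝ≥0∞} (hθ : θ ≠ 0) :
    ∃ K, ∀ k ≥ K, ∀ l ≥ k, ∫⁻ z, (ρ l z - ρ k z) ^ Q ∂μ ≤ θ := by
  have hQ0 : 0 < Q := by linarith
  obtain ⟨τ, hτ, hτM⟩ : ∃ τ : ℝ≥0, 0 < τ ∧ (τ : ℝ≥0∞) ^ Q * (M + M) ≤ θ / 2 := by
    have ht : Tendsto (fun τ : ℝ≥0 => (τ : ℝ≥0∞) ^ Q * (M + M)) (𝓝[>] 0) (𝓝 0) := by
      have h1 : Tendsto (fun τ : ℝ≥0 => (τ : ℝ≥0∞) ^ Q) (𝓝 0) (𝓝 0) := by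
        have : Continuous fun τ : ℝ≥0 => (τ : ℝ≥0∞) ^ Q :=
          ENNReal.continuous_rpow_const.comp ENNReal.continuous_coe
        simpa [ENNReal.zero_rpow_of_pos hQ0] using this.tendsto 0
      have := ENNReal.Tendsto.mul_const (b := M + M) h1 (Or.inr (by simp [hM]))
      rw [zero_mul] at this
      exact this.mono_left nhdsWithin_le_nhds
    have h2 : (0 : ℝ≥0∞) < θ / 2 := by simpa [pos_iff_ne_zero] using hθ
    obtain ⟨τ, h3, h4⟩ := ((ht.eventually_lt_const h2).and self_mem_nhdsWithin).exists
    exact ⟨τ, h4, h3.le⟩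
  obtain ⟨δ, hδ, hconv⟩ := exists_midpoint_rpow_add_le hQ hτ
  set A : ℕ → ℝ≥0∞ := fun k => pathModulus μ Q (Γ k) with hA
  have hAmono : Monotone A := fun k l hkl => pathModulus_mono (hΓ hkl)
  have hAtop : ∀ k, A k ≠ ∞ := fun k => ((h k).trans_lt hM.lt_top).ne
  have hsup : (⨆ k, A k) ≠ ∞ := ((iSup_le h).trans_lt hM.lt_top).ne
  have hδθ : (δ : ℝ≥0∞) * (θ / 2) ≠ 0 := by
    simp [hδ.ne', hθ]
  -- The midpoint of ρ k and ρ l is admissible for Γ k, so its energy is at least A k; from K on,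
  -- the averaged energies exceed this by at most δ θ / 2, which leaves little room for the
  -- convexity gap.
  obtain ⟨K, hK⟩ : ∃ K, ∀ k ≥ K, (⨆ k, A k) + e k ≤ A k + δ * (θ / 2) := by
    have h1 : Tendsto (fun k => (⨆ k, A k) + e k) atTop (𝓝 ((⨆ k, A k) + 0)) :=
      tendsto_const_nhds.add he
    have h2 : Tendsto (fun k => A k + δ * (θ / 2)) atTop (𝓝 ((⨆ k, A k) + δ * (θ / 2))) :=
      (tendsto_atTop_iSup hAmono).add tendsto_const_nhds
    have := h1.eventually_lt h2 (ENNReal.add_lt_add_left hsup (pos_iff_ne_zero.2 hδθ))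
    obtain ⟨K, hK⟩ := eventually_atTop.1 this
    exact ⟨K, fun k hk => (hK k hk).le⟩
  refine ⟨K, fun k hk l hl => ?_⟩
  have m := fun k => (hρ k).1
  have key : A k + δ * ∫⁻ z, (ρ l z - ρ k z) ^ Q ∂μ ≤ A k + (δ * (θ / 2) + δ * (θ / 2)) :=
    calc A k + δ * ∫⁻ z, (ρ l z - ρ k z) ^ Q ∂μ
        ≤ ∫⁻ z, (2⁻¹ * ρ k z + 2⁻¹ * ρ l z) ^ Q ∂μ + ∫⁻ z, δ * (ρ l z - ρ k z) ^ Q ∂μ := by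
          rw [lintegral_const_mul' _ _ (by simp)]
          gcongr
          exact ((hρ k).midpoint ((hρ l).subset (hΓ hl))).pathModulus_le
      _ = ∫⁻ z, (2⁻¹ * ρ k z + 2⁻¹ * ρ l z) ^ Q + δ * (ρ l z - ρ k z) ^ Q ∂μ := by
          rw [lintegral_add_left]
          exact (((m k).const_mul _).add ((m l).const_mul _)).pow_const Q
      _ ≤ ∫⁻ z, 2⁻¹ * ρ k z ^ Q + 2⁻¹ * ρ l z ^ Q + δ * (τ * ρ l z) ^ Q ∂μ :=
          lintegral_mono fun z => hconv _ _
      _ = 2⁻¹ * ∫⁻ z, ρ k z ^ Q ∂μ + 2⁻¹ * ∫⁻ z, ρ l z ^ Q ∂μ +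
            δ * (τ ^ Q * ∫⁻ z, ρ l z ^ Q ∂μ) := by
          rw [lintegral_add_left, lintegral_add_left, lintegral_const_mul' _ _ (by simp),
            lintegral_const_mul' _ _ (by simp), lintegral_const_mul' _ _ (by simp)]
          · simp_rw [ENNReal.mul_rpow_of_nonneg _ _ hQ0.le]
            rw [lintegral_const_mul' _ _ (by simp [hQ0.le])]
          · exact ((m k).pow_const Q).const_mul _
          · exact (((m k).pow_const Q).const_mul _).add (((m l).pow_const Q).const_mul _)
      _ ≤ 2⁻¹ * ((⨆ k, A k) + e k) + 2⁻¹ * ((⨆ k, A k) + e k) + δ * (τ ^ Q * (M + M)) := by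
          gcongr
          · exact (hle k).trans (add_le_add (le_iSup A k) le_rfl)
          · exact (hle l).trans (add_le_add (le_iSup A l) (heanti hl))
          · exact (hle l).trans (add_le_add (h l) (heM l))
      _ ≤ (⨆ k, A k) + e k + δ * (θ / 2) := by
          rw [← add_mul, ENNReal.inv_two_add_inv_two, one_mul]
          gcongr
      _ ≤ A k + δ * (θ / 2) + δ * (θ / 2) := by
          gcongr ?_ + _
          exact hK k hk
      _ = _ := add_assoc _ _ _
  rw [← mul_add, ENNReal.add_halves, ENNReal.add_le_add_iff_left (hAtop k)] at key
  exact (ENNReal.mul_le_mul_iff_right (by simp [hδ.ne']) (by simp)).1 key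

/-- For `Q > 1`, the modulus of the union of an increasing sequence of path families is
controlled by the moduli of these families. -/
theorem pathModulus_iUnion_le (hQ : 1 < Q) {Γ : ℕ → Set (IntervalPath Z)} (hΓ : Monotone Γ)
    {M : ℝ≥0∞} (hM0 : M ≠ 0) (hM : M ≠ ∞) (h : ∀ k, pathModulus μ Q (Γ k) ≤ M) :
    pathModulus μ Q (⋃ k, Γ k) ≤ 2 ^ (Q - 1) * (2 + 2 ^ Q * 2) * M := by
  have hQ0 : 0 < Q := by linarith
  -- These errors are positive since M ≠ 0, and their sum 2M is of the order of the target bound.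
  set e : ℕ → ℝ≥0∞ := fun k => M * 2⁻¹ ^ k with he
  have he0 : ∀ k, e k ≠ 0 := fun k => by simp [he, hM0]
  have heM : ∀ k, e k ≤ M := fun k => by
    simpa [he] using mul_le_mul_right (pow_le_one₀ (n := k) (zero_le : (0 : ℝ≥0∞) ≤ 2⁻¹) (by simp)) M
  have heanti : Antitone e := fun k l hkl =>
    mul_le_mul_right (pow_le_pow_of_le_one (by simp) (by simp) hkl) M
  have het : Tendsto e atTop (𝓝 0) := by
    have := ENNReal.Tendsto.const_mul (a := M)
      (ENNReal.tendsto_pow_atTop_nhds_zero_of_lt_one (r := 2⁻¹) (by simp)) (Or.inr hM)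
    rwa [mul_zero] at this
  have hesum : ∑' k, e k = M * 2 := by
    rw [he, ENNReal.tsum_mul_left, ENNReal.tsum_geometric, ENNReal.one_sub_inv_two, inv_inv]
  choose ρ hρ hle using fun k => exists_admissibleFor_lt
    (ENNReal.lt_add_right ((h k).trans_lt hM.lt_top).ne (he0 k))
  -- This threshold cancels the weight (2 ^ j) ^ Q of `ENNReal.tsum_rpow_le`, leaving the summable e
  -- j.
  have hθ : ∀ j, e j / (2 ^ j) ^ Q ≠ 0 := fun j => by
    simp [he0, ENNReal.rpow_eq_top_iff]
  obtain ⟨n, hn, hnle⟩ := extraction_forall_of_eventually' fun j =>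
    exists_forall_lintegral_sub_rpow_le hQ hΓ hM h hρ het heanti heM (fun k => (hle k).le) (hθ j)
  let d : ℕ → Z → ℝ≥0∞ := fun j z => ρ (n (j + 1)) z - ρ (n j) z
  have hd : ∀ j, Measurable (d j) := fun j => (hρ _).1.sub (hρ _).1
  -- Truncated differences telescope to an upper bound, so g majorizes every ρ (n j) and is
  -- admissible for the whole union; no limit function is needed.
  let g : Z → ℝ≥0∞ := fun z => ρ (n 0) z + ∑' j, d j z
  have hdm : Measurable fun z => ∑' j, d j z := Measurable.tsum hd
  have hg : Measurable g := (hρ _).1.add hdm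
  have hρg : ∀ j, ρ (n j) ≤ g := by
    intro j z
    refine le_trans ?_ (add_le_add le_rfl (ENNReal.sum_le_tsum (Finset.range j)))
    induction j with
    | zero => simp
    | succ j ih =>
      rw [Finset.sum_range_succ, ← add_assoc]
      exact le_add_tsub.trans (add_le_add ih le_rfl)
  have hadm : AdmissibleFor g (⋃ k, Γ k) := by
    refine ⟨hg, fun γ hγ hr => ?_⟩
    obtain ⟨k, hk⟩ := mem_iUnion.1 hγ
    exact ((hρ (n k)).mono hg (hρg k)).2 γ (hΓ (hn.le_apply) hk) hr
  refine hadm.pathModulus_le.trans ?_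
  calc ∫⁻ z, g z ^ Q ∂μ
      ≤ ∫⁻ z, 2 ^ (Q - 1) * (ρ (n 0) z ^ Q + 2 ^ Q * ∑' j, (2 ^ j) ^ Q * d j z ^ Q) ∂μ := by
        refine lintegral_mono fun z => ?_
        refine (ENNReal.rpow_add_le_mul_rpow_add_rpow _ _ hQ.le).trans ?_
        gcongr
        exact ENNReal.tsum_rpow_le hQ0 _
    _ = 2 ^ (Q - 1) * (∫⁻ z, ρ (n 0) z ^ Q ∂μ +
          2 ^ Q * ∑' j, (2 ^ j) ^ Q * ∫⁻ z, d j z ^ Q ∂μ) := by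
        have h2 : ∀ r : ℝ, 0 ≤ r → (2 : ℝ≥0∞) ^ r ≠ ∞ := fun r hr =>
          ENNReal.rpow_ne_top_of_nonneg hr (by simp)
        rw [lintegral_const_mul' _ _ (h2 _ (by linarith)), lintegral_add_left
          ((hρ _).1.pow_const Q), lintegral_const_mul' _ _ (h2 _ hQ0.le), lintegral_tsum]
        · congr 4 with j
          rw [lintegral_const_mul' _ _ (ENNReal.rpow_ne_top_of_nonneg hQ0.le (by simp))]
        · exact fun j => (((hd j).pow_const Q).const_mul _).aemeasurable
    _ ≤ 2 ^ (Q - 1) * ((M + M) + 2 ^ Q * ∑' j, e j) := by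
        gcongr with j
        · exact (hle _).le.trans (add_le_add (h _) (heM _))
        · refine (mul_le_mul_right (hnle j _ (hn.monotone j.le_succ)) _).trans ?_
          exact ENNReal.mul_div_le
    _ = _ := by rw [hesum]; ring

end Modulus

/-! ### Nets, images of balls, chains and bounded overlap -/

/-- A compact metric space contains finite separated nets. -/
theorem exists_finset_separated_net (Z : Type*) [MetricSpace Z] [CompactSpace Z] {ε : ℝ}
    (hε : 0 < ε) :
    ∃ s : Finset Z, (∀ x ∈ s, ∀ y ∈ s, x ≠ y → ε < dist x y) ∧
      ∀ z, ∃ x ∈ s, dist z x ≤ ε := by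
  lift ε to ℝ≥0 using hε.le
  have hε' : ε / 2 ≠ 0 := by
    have : 0 < ε := by exact_mod_cast hε
    positivity
  have hfin : Metric.packingNumber ε (univ : Set Z) ≠ ⊤ := by
    have h1 := Metric.packingNumber_two_mul_le_externalCoveringNumber (ε / 2) (univ : Set Z)
    rw [mul_div_cancel₀ _ two_ne_zero] at h1
    obtain ⟨N, -, hN, hc⟩ := Metric.exists_finite_isCover_of_totallyBounded hε'
      (isCompact_univ (X := Z)).totallyBounded
    exact ((h1.trans hc.externalCoveringNumber_le_encard).trans_lt hN.encard_lt_top).ne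
  have hsf : (Metric.maximalSeparatedSet ε (univ : Set Z)).Finite := by
    rw [← Set.encard_ne_top_iff, Metric.encard_maximalSeparatedSet hfin]
    exact hfin
  refine ⟨hsf.toFinset, fun x hx y hy hxy => ?_, fun z => ?_⟩
  · have : (ε : ℝ≥0∞) < edist x y := Metric.isSeparated_maximalSeparatedSet
      (hsf.mem_toFinset.1 hx) (hsf.mem_toFinset.1 hy) hxy
    rw [edist_nndist, ENNReal.coe_lt_coe] at this
    exact_mod_cast this
  · obtain ⟨x, hx, hd⟩ := Metric.isCover_maximalSeparatedSet hfin (mem_univ z)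
    refine ⟨x, hsf.mem_toFinset.2 hx, ?_⟩
    have hd' : edist z x ≤ ε := hd
    rw [edist_nndist, ENNReal.coe_le_coe] at hd'
    exact_mod_cast hd'

/-- A power of a finite sum is controlled by the sum of the powers. -/
theorem ENNReal.sum_rpow_le {ι : Type*} {Q : ℝ} (hQ : 0 < Q) (s : Finset ι) (a : ι → ℝ≥0∞) :
    (∑ i ∈ s, a i) ^ Q ≤ (s.card : ℝ≥0∞) ^ Q * ∑ i ∈ s, a i ^ Q := by
  have h : ∀ i ∈ s, a i ≤ (∑ i ∈ s, a i ^ Q) ^ (1 / Q) := fun i hi => by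
    rw [one_div, ENNReal.le_rpow_inv_iff hQ]
    exact Finset.single_le_sum (f := fun i => a i ^ Q) (fun _ _ => zero_le) hi
  calc (∑ i ∈ s, a i) ^ Q ≤ (s.card * (∑ i ∈ s, a i ^ Q) ^ (1 / Q)) ^ Q := by
        gcongr
        simpa using Finset.sum_le_card_nsmul s a _ h
    _ = _ := by
        rw [ENNReal.mul_rpow_of_nonneg _ _ hQ.le, ← ENNReal.rpow_mul,
          one_div_mul_cancel hQ.ne', ENNReal.rpow_one]

/-- The weak form of quasisymmetry, with constant `H`. -/
def WeakQuasisymmetric {Z W : Type*} [MetricSpace Z] [MetricSpace W] (H : ℝ) (φ : Z → W) : Prop :=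
  ∀ z z' z'' : Z, dist z z' ≤ 2 * dist z z'' → dist (φ z) (φ z') ≤ H * dist (φ z) (φ z'')

section Radius

variable {Z W : Type*} [MetricSpace Z] [CompactSpace Z] [MetricSpace W] [CompactSpace W]

/-- Images of balls under weakly quasisymmetric maps are comparable to balls. -/
theorem WeakQuasisymmetric.exists_radius {H : ℝ} (hH : 0 < H) {φ : Z → W} (hφc : Continuous φ)
    (hφ : WeakQuasisymmetric H φ) {ε : ℝ} (hε : 0 < ε) (z : Z) :
    ∃ R : ℝ, 0 ≤ R ∧ R ≤ Metric.diam (univ : Set W) ∧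
      (∀ z', dist z' z ≤ ε → dist (φ z') (φ z) ≤ R) ∧
      ∀ z', dist (φ z') (φ z) < R / H → dist z' z < ε / 2 := by
  -- R is attained at p in the closed ball. A point z' with d(z', z) ≥ ε/2 satisfies d(z, p) ≤ 2
  -- d(z, z'), so R ≤ H d(φ z, φ z'); this is why the weak condition carries the factor 2.
  obtain ⟨p, hp, hmax⟩ := (isCompact_univ.of_isClosed_subset Metric.isClosed_closedBall
    (subset_univ (Metric.closedBall z ε))).exists_isMaxOn ⟨z, Metric.mem_closedBall_self hε.le⟩
    (hφc.dist (continuous_const (y := φ z))).continuousOn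
  refine ⟨dist (φ p) (φ z), dist_nonneg, Metric.dist_le_diam_of_mem isCompact_univ.isBounded
    (mem_univ _) (mem_univ _), fun z' hz' => hmax (Metric.mem_closedBall.2 hz'), fun z' hz' => ?_⟩
  by_contra! hlt
  have hp' : dist p z ≤ ε := Metric.mem_closedBall.1 hp
  have := hφ z p z' (by rw [dist_comm z p, dist_comm z z']; linarith)
  rw [lt_div_iff₀ hH] at hz'
  rw [dist_comm (φ z), dist_comm (φ z)] at this
  linarith

end Radius

/-- A connected set covered by finitely many balls has diameter at most the sum of the diameters
of these balls. -/
theorem edist_le_sum_of_isPreconnected {X W ι : Type*} [TopologicalSpace X] [MetricSpace W]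
    {f : X → W} (hf : Continuous f) {K : Set X} (hK : IsPreconnected K) {x y : X} (hx : x ∈ K)
    (hy : y ∈ K) (T : Finset ι) (w : ι → W) (R : ι → ℝ)
    (hcov : ∀ t ∈ K, ∃ i ∈ T, dist (f t) (w i) ≤ R i) :
    edist (f x) (f y) ≤ 2 * ∑ i ∈ T, ENNReal.ofReal (R i) := by
  -- The distance to f x turns the chain into a covering of a real interval by intervals of length 2
  -- R i, where Lebesgue measure is subadditive.
  let u : X → ℝ := fun t => dist (f t) (f x)
  have hu : Continuous u := hf.dist continuous_const
  have h1 : Icc (u x) (u y) ⊆ u '' K := hK.intermediate_value hx hy hu.continuousOn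
  have h2 : u '' K ⊆ ⋃ i ∈ T, Icc (dist (w i) (f x) - R i) (dist (w i) (f x) + R i) := by
    rintro _ ⟨t, ht, rfl⟩
    obtain ⟨i, hi, hd⟩ := hcov t ht
    refine mem_iUnion₂.2 ⟨i, hi, ?_⟩
    have h3 := dist_triangle (f t) (w i) (f x)
    have h4 := dist_triangle (w i) (f t) (f x)
    rw [dist_comm (w i) (f t)] at h4
    constructor <;> simp only [u] <;> linarith
  calc edist (f x) (f y) = volume (Icc (u x) (u y)) := by
        simp [u, edist_dist, dist_comm]
    _ ≤ ∑ i ∈ T, volume (Icc (dist (w i) (f x) - R i) (dist (w i) (f x) + R i)) :=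
        (measure_mono (h1.trans h2)).trans (measure_biUnion_finset_le _ _)
    _ = 2 * ∑ i ∈ T, ENNReal.ofReal (R i) := by
        rw [Finset.mul_sum]
        refine Finset.sum_congr rfl fun i _ => ?_
        rw [Real.volume_Icc, ← ENNReal.ofReal_ofNat 2, ← ENNReal.ofReal_mul zero_le_two]
        congr 1
        ring

open scoped Classical in
/-- In an Ahlfors regular space, the balls of radius `2 * ε` around an `ε`-separated set have
bounded overlap. -/
theorem AhlforsRegular.card_filter_le {Z : Type*} [MetricSpace Z] [MeasurableSpace Z]
    [BorelSpace Z] {μ : Measure Z} {Q a b : ℝ} (h : AhlforsRegular μ Q a b) (ha : 0 < a)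
    (hb : 0 < b) {ε : ℝ} (hε : 0 < ε) (hεd : 3 * ε ≤ Metric.diam (univ : Set Z)) {s : Finset Z}
    (hs : ∀ x ∈ s, ∀ y ∈ s, x ≠ y → ε < dist x y) (z : Z) :
    ((s.filter fun i => z ∈ Metric.ball i (2 * ε)).card : ℝ) ≤ b / a * 6 ^ Q := by
  set T := s.filter fun i => z ∈ Metric.ball i (2 * ε)
  have hpos : 0 < a * (ε / 2) ^ Q := by positivity
  have hdisj : (T : Set Z).PairwiseDisjoint fun i => Metric.ball i (ε / 2) := by
    intro x hx y hy hxy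
    refine Metric.ball_disjoint_ball ?_
    have := hs x (Finset.mem_filter.1 hx).1 y (Finset.mem_filter.1 hy).1 hxy
    linarith
  have key : (T.card : ℝ≥0∞) * ENNReal.ofReal (a * (ε / 2) ^ Q) ≤
      ENNReal.ofReal (b * (3 * ε) ^ Q) :=
    calc (T.card : ℝ≥0∞) * ENNReal.ofReal (a * (ε / 2) ^ Q)
        = ∑ i ∈ T, ENNReal.ofReal (a * (ε / 2) ^ Q) := by simp
      _ ≤ ∑ i ∈ T, μ (Metric.ball i (ε / 2)) := by
          gcongr with i
          exact (h i (ε / 2) (by positivity) (by linarith)).1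
      _ = μ (⋃ i ∈ T, Metric.ball i (ε / 2)) :=
          (measure_biUnion_finset hdisj fun i _ => Metric.isOpen_ball.measurableSet).symm
      _ ≤ μ (Metric.ball z (3 * ε)) := by
          refine measure_mono (iUnion₂_subset fun i hi => ?_)
          refine Metric.ball_subset_ball' ?_
          have : dist z i < 2 * ε := (Finset.mem_filter.1 hi).2
          rw [dist_comm]
          linarith
      _ ≤ _ := (h z (3 * ε) (by positivity) hεd).2
  rw [← ENNReal.ofReal_natCast, ← ENNReal.ofReal_mul (Nat.cast_nonneg _),
    ENNReal.ofReal_le_ofReal_iff (by positivity), ← le_div_iff₀ hpos] at key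
  refine key.trans_eq ?_
  have : (3 * ε : ℝ) ^ Q = 6 ^ Q * (ε / 2) ^ Q := by
    rw [← Real.mul_rpow (by norm_num) (by positivity)]
    congr 1
    ring
  rw [this]
  have : (ε / 2) ^ Q ≠ 0 := (Real.rpow_pos_of_pos (by positivity) Q).ne'
  field_simp

/-- The constant in the energy estimate for the discretization of a density. -/
def discretizationConst (Q H a b a' : ℝ) : ℝ≥0∞ :=
  ENNReal.ofReal (b / a * 6 ^ Q) ^ Q * ENNReal.ofReal (b * 2 ^ Q) * ENNReal.ofReal (H ^ Q / a')

/-! ### Discretized pullback of a density -/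

section Discretization

variable {Z W : Type*} [MetricSpace Z] [CompactSpace Z] [MeasurableSpace Z] [BorelSpace Z]
  [MetricSpace W] [CompactSpace W] [MeasurableSpace W] [BorelSpace W]

/-- The discretization, at a scale `ε`, of the pullback of a density `ρ` under a weakly
quasisymmetric homeomorphism. -/
theorem exists_discretization {μ : Measure Z} {ν : Measure W} {Q H a b a' b' : ℝ} (hQ : 0 < Q)
    (hH : 1 ≤ H) (ha : 0 < a) (hb : 0 < b) (ha' : 0 < a') (hμ : AhlforsRegular μ Q a b)
    (hν : AhlforsRegular ν Q a' b') (φ : Z ≃ₜ W) (hφ : WeakQuasisymmetric H φ)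
    (ρ : W → ℝ≥0∞) {ε : ℝ} (hε : 0 < ε) (hεd : 3 * ε ≤ Metric.diam (univ : Set Z)) :
    ∃ σ : Z → ℝ≥0∞, Measurable σ ∧
      ∫⁻ z, σ z ^ Q ∂μ ≤ discretizationConst Q H a b a' * ∫⁻ w, ρ w ^ Q ∂ν ∧
      ∀ γ : IntervalPath Z, γ.Rectifiable → ∀ K : Set γ.domain, K.OrdConnected →
        ∀ x ∈ K, ∀ y ∈ K, 2 * ε ≤ dist (γ.toFun x) (γ.toFun y) → ∀ m : ℝ≥0∞,
          (∀ t ∈ K, ∀ z, dist z (γ.toFun t) < 2 * ε → m ≤ ρ (φ z)) →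
          m * edist (φ (γ.toFun x)) (φ (γ.toFun y)) ≤
            2 * ∫⁻ t in K, σ (γ.toFun t) ∂γ.arclengthMeasure := by
  classical
  have hH0 : 0 < H := by linarith
  obtain ⟨s, hsep, hcov⟩ := exists_finset_separated_net Z hε
  choose R hR0 hRd hRφ hRinv using fun z => hφ.exists_radius hH0 φ.continuous hε z
  -- The infimum keeps the energy below that of ρ on the image of the half-size ball; dividing R i
  -- by ε makes a piece of length ε contribute m i * R i.
  let m : Z → ℝ≥0∞ := fun i => ⨅ z ∈ Metric.ball i ε, ρ (φ z)
  let c : Z → ℝ≥0∞ := fun i => m i * ENNReal.ofReal (R i / ε)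
  let σ : Z → ℝ≥0∞ := fun z => ∑ i ∈ s, (Metric.ball i (2 * ε)).indicator (fun _ => c i) z
  have hσ : Measurable σ := Finset.measurable_sum _ fun i _ =>
    measurable_const.indicator Metric.isOpen_ball.measurableSet
  refine ⟨σ, hσ, ?_, ?_⟩
  · have hpt : ∀ z, σ z ^ Q ≤ ENNReal.ofReal (b / a * 6 ^ Q) ^ Q *
        ∑ i ∈ s, (Metric.ball i (2 * ε)).indicator (fun _ => c i ^ Q) z := by
      intro z
      have e1 : σ z = ∑ i ∈ s.filter (fun i => z ∈ Metric.ball i (2 * ε)), c i := by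
        rw [Finset.sum_filter]
        exact Finset.sum_congr rfl fun i _ => by simp only [indicator_apply]
      have e2 : ∑ i ∈ s, (Metric.ball i (2 * ε)).indicator (fun _ => c i ^ Q) z =
          ∑ i ∈ s.filter (fun i => z ∈ Metric.ball i (2 * ε)), c i ^ Q := by
        rw [Finset.sum_filter]
        exact Finset.sum_congr rfl fun i _ => by simp only [indicator_apply]
      rw [e1, e2]
      refine (ENNReal.sum_rpow_le hQ _ _).trans ?_
      gcongr
      rw [← ENNReal.ofReal_natCast]
      exact ENNReal.ofReal_le_ofReal (hμ.card_filter_le ha hb hε hεd hsep z)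
    have hball : ∀ i, c i ^ Q * μ (Metric.ball i (2 * ε)) ≤
        ENNReal.ofReal (b * 2 ^ Q) * ENNReal.ofReal (H ^ Q / a') *
          ∫⁻ w in φ '' Metric.ball i (ε / 2), ρ w ^ Q ∂ν := by
      intro i
      rcases (hR0 i).eq_or_lt with h0 | hRi
      -- A zero radius gives zero weight; regularity of ν is available only at positive radii.
      · simp [c, ← h0, hQ]
      have hW : ENNReal.ofReal (R i ^ Q) ≤
          ENNReal.ofReal (H ^ Q / a') * ν (φ '' Metric.ball i (ε / 2)) := by
        have h1 := (hν (φ i) (R i / H) (by positivity)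
          ((div_le_self hRi.le hH).trans (hRd i))).1
        have h2 : Metric.ball (φ i) (R i / H) ⊆ φ '' Metric.ball i (ε / 2) := by
          intro w hw
          refine ⟨φ.symm w, hRinv i _ ?_, φ.apply_symm_apply w⟩
          rwa [φ.apply_symm_apply]
        calc ENNReal.ofReal (R i ^ Q)
            = ENNReal.ofReal (H ^ Q / a') * ENNReal.ofReal (a' * (R i / H) ^ Q) := by
              rw [← ENNReal.ofReal_mul (by positivity), Real.div_rpow hRi.le hH0.le]
              congr 1
              have : H ^ Q ≠ 0 := (Real.rpow_pos_of_pos hH0 Q).ne'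
              field_simp
          _ ≤ _ := by
              gcongr
              exact h1.trans (measure_mono h2)
      have hm : m i ^ Q * ν (φ '' Metric.ball i (ε / 2)) ≤
          ∫⁻ w in φ '' Metric.ball i (ε / 2), ρ w ^ Q ∂ν := by
        rw [← setLIntegral_const]
        refine setLIntegral_mono' (φ.isOpenMap _ Metric.isOpen_ball).measurableSet ?_
        rintro _ ⟨z, hz, rfl⟩
        gcongr
        exact iInf₂_le z (Metric.ball_subset_ball (by linarith) hz)
      calc c i ^ Q * μ (Metric.ball i (2 * ε))
          ≤ (m i ^ Q * ENNReal.ofReal ((R i / ε) ^ Q)) * ENNReal.ofReal (b * (2 * ε) ^ Q) := by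
            simp only [c]
            rw [ENNReal.mul_rpow_of_nonneg _ _ hQ.le,
              ENNReal.ofReal_rpow_of_nonneg (by positivity) hQ.le]
            gcongr
            exact (hμ i (2 * ε) (by positivity) (by linarith)).2
        _ = ENNReal.ofReal (b * 2 ^ Q) * (m i ^ Q * ENNReal.ofReal (R i ^ Q)) := by
            rw [mul_assoc, ← ENNReal.ofReal_mul (by positivity), mul_left_comm (ENNReal.ofReal _),
              ← ENNReal.ofReal_mul (by positivity)]
            congr 2
            rw [Real.div_rpow hRi.le hε.le, Real.mul_rpow zero_le_two hε.le]
            have : ε ^ Q ≠ 0 := (Real.rpow_pos_of_pos hε Q).ne'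
            field_simp
        _ ≤ ENNReal.ofReal (b * 2 ^ Q) * (m i ^ Q *
              (ENNReal.ofReal (H ^ Q / a') * ν (φ '' Metric.ball i (ε / 2)))) := by gcongr
        _ = ENNReal.ofReal (b * 2 ^ Q) * ENNReal.ofReal (H ^ Q / a') *
              (m i ^ Q * ν (φ '' Metric.ball i (ε / 2))) := by ring
        _ ≤ _ := by gcongr
    have hdisj : (s : Set Z).PairwiseDisjoint fun i => φ '' Metric.ball i (ε / 2) := by
      intro x hx y hy hxy
      refine (disjoint_image_iff φ.injective).2 (Metric.ball_disjoint_ball ?_)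
      have := hsep x hx y hy hxy
      linarith
    have hDtop : ENNReal.ofReal (b / a * 6 ^ Q) ^ Q ≠ ∞ :=
      ENNReal.rpow_ne_top_of_nonneg hQ.le ENNReal.ofReal_ne_top
    calc ∫⁻ z, σ z ^ Q ∂μ
        ≤ ∫⁻ z, ENNReal.ofReal (b / a * 6 ^ Q) ^ Q *
            ∑ i ∈ s, (Metric.ball i (2 * ε)).indicator (fun _ => c i ^ Q) z ∂μ :=
          lintegral_mono hpt
      _ = ENNReal.ofReal (b / a * 6 ^ Q) ^ Q * ∑ i ∈ s, c i ^ Q * μ (Metric.ball i (2 * ε)) := by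
          rw [lintegral_const_mul' _ _ hDtop, lintegral_finsetSum]
          · simp_rw [lintegral_indicator_const Metric.isOpen_ball.measurableSet]
          · exact fun i _ => measurable_const.indicator Metric.isOpen_ball.measurableSet
      _ ≤ ENNReal.ofReal (b / a * 6 ^ Q) ^ Q * ∑ i ∈ s, ENNReal.ofReal (b * 2 ^ Q) *
            ENNReal.ofReal (H ^ Q / a') * ∫⁻ w in φ '' Metric.ball i (ε / 2), ρ w ^ Q ∂ν := by
          exact mul_le_mul_right (Finset.sum_le_sum fun i _ => hball i) _
      _ = discretizationConst Q H a b a' *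
            ∫⁻ w in ⋃ i ∈ s, φ '' Metric.ball i (ε / 2), ρ w ^ Q ∂ν := by
          rw [lintegral_biUnion_finset hdisj fun i _ =>
            (φ.isOpenMap _ Metric.isOpen_ball).measurableSet, ← Finset.mul_sum,
            discretizationConst]
          ring
      _ ≤ _ := by
          exact mul_le_mul_right (setLIntegral_le_lintegral _ _) _
  · intro γ hγ K hK x hx y hy hxy m₀ hm₀
    let T := s.filter fun i => ∃ t ∈ K, dist (γ.toFun t) i ≤ ε
    have hchain := edist_le_sum_of_isPreconnected (φ.continuous.comp γ.continuous_toFun)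
      (IntervalPath.isPreconnected_of_ordConnected hK) hx hy T φ R (by
        intro t ht
        obtain ⟨i, hi, hd⟩ := hcov (γ.toFun t)
        exact ⟨i, Finset.mem_filter.2 ⟨hi, t, ht, hd⟩, hRφ i _ hd⟩)
    have hmeas : ∀ i, MeasurableSet (γ.toFun ⁻¹' Metric.ball i (2 * ε)) := fun i =>
      (Metric.isOpen_ball.preimage γ.continuous_toFun).measurableSet
    have hint : ∫⁻ t in K, σ (γ.toFun t) ∂γ.arclengthMeasure =
        ∑ i ∈ s, c i * γ.arclengthMeasure (γ.toFun ⁻¹' Metric.ball i (2 * ε) ∩ K) := by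
      have : ∀ t, σ (γ.toFun t) =
          ∑ i ∈ s, (γ.toFun ⁻¹' Metric.ball i (2 * ε)).indicator (fun _ => c i) t := fun t => rfl
      simp_rw [this]
      rw [lintegral_finsetSum _ fun i _ => measurable_const.indicator (hmeas i)]
      refine Finset.sum_congr rfl fun i _ => ?_
      rw [lintegral_indicator_const (hmeas i), Measure.restrict_apply (hmeas i)]
    have hone : ∀ i ∈ T, m₀ * ENNReal.ofReal (R i) ≤
        c i * γ.arclengthMeasure (γ.toFun ⁻¹' Metric.ball i (2 * ε) ∩ K) := by
      intro i hi
      obtain ⟨-, t, ht, htd⟩ := Finset.mem_filter.1 hi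
      have h1 : ENNReal.ofReal ε ≤
          γ.arclengthMeasure (γ.toFun ⁻¹' Metric.ball i (2 * ε) ∩ K) := by
        -- Since x and y are 2ε apart, one of them is at least ε from γ(t); the subarc towards it
        -- provides length ε inside B(i, 2ε).
        obtain ⟨y', hy', hd⟩ : ∃ y' ∈ K, ε ≤ dist (γ.toFun t) (γ.toFun y') := by
          by_contra! hcon
          have := dist_triangle_left (γ.toFun x) (γ.toFun y) (γ.toFun t)
          linarith [hcon x hx, hcon y hy]
        refine (hγ.le_arclengthMeasure_inter_ball hK ht hy' hd).trans (measure_mono ?_)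
        rintro t' ⟨ht', hd'⟩
        refine ⟨?_, ht'⟩
        have := dist_triangle (γ.toFun t') (γ.toFun t) i
        have hd'' : dist (γ.toFun t') (γ.toFun t) < ε := hd'
        change dist (γ.toFun t') i < 2 * ε
        linarith
      have h2 : m₀ ≤ m i := by
        refine le_iInf₂ fun z hz => hm₀ t ht z ?_
        have := dist_triangle_right z (γ.toFun t) i
        have hz' : dist z i < ε := hz
        linarith
      calc m₀ * ENNReal.ofReal (R i) = m₀ * ENNReal.ofReal (R i / ε) * ENNReal.ofReal ε := by
            rw [mul_assoc, ← ENNReal.ofReal_mul (by have := hR0 i; positivity),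
              div_mul_cancel₀ _ hε.ne']
        _ ≤ _ := by
            simp only [c]
            gcongr
    calc m₀ * edist (φ (γ.toFun x)) (φ (γ.toFun y))
        ≤ m₀ * (2 * ∑ i ∈ T, ENNReal.ofReal (R i)) := by gcongr; exact hchain
      _ = 2 * ∑ i ∈ T, m₀ * ENNReal.ofReal (R i) := by rw [mul_left_comm, Finset.mul_sum]
      _ ≤ 2 * ∑ i ∈ T, c i * γ.arclengthMeasure (γ.toFun ⁻¹' Metric.ball i (2 * ε) ∩ K) := by
          exact mul_le_mul_right (Finset.sum_le_sum hone) _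
      _ ≤ 2 * ∑ i ∈ s, c i * γ.arclengthMeasure (γ.toFun ⁻¹' Metric.ball i (2 * ε) ∩ K) := by
          gcongr
          exact Finset.filter_subset _ _
      _ = _ := by rw [hint]

end Discretization

/-! ### Path integrals in the limit of small scales -/

/-- Lower limits of integrals are superadditive as functions of the domain of integration. -/
theorem tsum_liminf_setLIntegral_le {α ι : Type*} [MeasurableSpace α] [Countable ι]
    {μ : Measure α} (f : ℕ → α → ℝ≥0∞) {s : ι → Set α} {t : Set α}
    (hs : ∀ i, MeasurableSet (s i)) (hd : Pairwise (Function.onFun Disjoint s))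
    (hst : ∀ i, s i ⊆ t) :
    ∑' i, liminf (fun n => ∫⁻ x in s i, f n x ∂μ) atTop ≤
      liminf (fun n => ∫⁻ x in t, f n x ∂μ) atTop := by
  let : MeasurableSpace ι := ⊤
  calc ∑' i, liminf (fun n => ∫⁻ x in s i, f n x ∂μ) atTop
      = ∫⁻ i, liminf (fun n => ∫⁻ x in s i, f n x ∂μ) atTop ∂Measure.count :=
        (lintegral_count _).symm
    -- Fatou's lemma for the counting measure on the index set.
    _ ≤ liminf (fun n => ∫⁻ i, ∫⁻ x in s i, f n x ∂μ ∂Measure.count) atTop :=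
        lintegral_liminf_le fun n => measurable_from_top
    _ ≤ _ := by
        refine liminf_le_liminf (Eventually.of_forall fun n => ?_)
        change ∫⁻ i, ∫⁻ x in s i, f n x ∂μ ∂Measure.count ≤ _
        rw [lintegral_count, ← lintegral_iUnion hs hd]
        exact lintegral_mono_set (iUnion_subset hst)

/-- The infimum of a function over balls of a fixed radius. -/
def infBall {W : Type*} [MetricSpace W] (ρ : W → ℝ≥0∞) (r : ℝ) (w : W) : ℝ≥0∞ :=
  ⨅ v ∈ Metric.ball w r, ρ v

section InfBall

variable {W : Type*} [MetricSpace W] {ρ : W → ℝ≥0∞}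

theorem infBall_le {r : ℝ} {v w : W} (h : dist v w < r) : infBall ρ r w ≤ ρ v :=
  iInf₂_le v (Metric.mem_ball.2 h)

/-- Strict sublevel sets are unions of open balls, whatever ρ is. -/
theorem measurable_infBall [MeasurableSpace W] [BorelSpace W] (ρ : W → ℝ≥0∞) (r : ℝ) :
    Measurable (infBall ρ r) := by
  refine measurable_of_Iio fun c => IsOpen.measurableSet ?_
  have : infBall ρ r ⁻¹' Iio c = ⋃ v ∈ {v | ρ v < c}, Metric.ball v r := by
    ext w
    simp only [infBall, mem_preimage, mem_Iio, iInf_lt_iff, Metric.mem_ball, mem_ofPred_eq,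
      mem_iUnion, exists_prop]
    exact exists_congr fun v => by rw [dist_comm, and_comm]
  rw [this]
  exact isOpen_biUnion fun v _ => Metric.isOpen_ball

theorem infBall_anti {r r' : ℝ} (h : r ≤ r') (w : W) : infBall ρ r' w ≤ infBall ρ r w :=
  biInf_mono fun _ hv => Metric.ball_subset_ball h hv

theorem LowerSemicontinuous.iSup_infBall (hρ : LowerSemicontinuous ρ) (w : W) :
    ⨆ n : ℕ, infBall ρ (1 / ((n : ℝ) + 1)) w = ρ w := by
  refine le_antisymm (iSup_le fun n => infBall_le (by rw [dist_self]; positivity)) ?_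
  refine le_of_forall_lt fun c hc => ?_
  obtain ⟨c', hcc', hc'⟩ := exists_between hc
  obtain ⟨ε, hε, hball⟩ := Metric.eventually_nhds_iff.1 (hρ w c' hc')
  obtain ⟨n, hn⟩ := exists_nat_one_div_lt hε
  refine hcc'.trans_le (le_iSup_of_le n (le_iInf₂ fun v hv => ?_))
  exact (hball ((Metric.mem_ball.1 hv).trans hn)).le

end InfBall

namespace IntervalPath

variable {Z W : Type*} [MetricSpace Z] [MetricSpace W]

/-- The lower limit of the integrals of a sequence of densities over a part of a path. -/
def lowerIntegral (γ : IntervalPath Z) (σ : ℕ → Z → ℝ≥0∞) (K : Set γ.domain) : ℝ≥0∞ :=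
  liminf (fun n => ∫⁻ t in K, σ n (γ.toFun t) ∂γ.arclengthMeasure) atTop

/-- The sequence `σ` of densities asymptotically dominates the pullback of `ρ` under `φ` on
subarcs of `γ`. -/
def Dominates (γ : IntervalPath Z) (φ : C(Z, W)) (ρ : W → ℝ≥0∞) (σ : ℕ → Z → ℝ≥0∞) : Prop :=
  ∀ K : Set γ.domain, K.OrdConnected → ∀ x ∈ K, ∀ y ∈ K, ∀ m : ℝ≥0∞, ∀ r > 0,
    (∀ t ∈ K, ∀ w, dist w (φ (γ.toFun t)) < r → m ≤ ρ w) →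
      m * edist (φ (γ.toFun x)) (φ (γ.toFun y)) ≤ 2 * γ.lowerIntegral σ K

variable {γ : IntervalPath Z} {φ : C(Z, W)} {ρ : W → ℝ≥0∞} {σ : ℕ → Z → ℝ≥0∞}

/-- Domination on each interval of a partition adds up, because lower limits are superadditive over
disjoint pieces. -/
theorem Dominates.mul_eVariationOn_le (h : γ.Dominates φ ρ σ) (hγ : γ.Rectifiable)
    {K : Set γ.domain} (hK : K.OrdConnected) {m : ℝ≥0∞} {r : ℝ} (hr : 0 < r)
    (hm : ∀ t ∈ K, ∀ w, dist w (φ (γ.toFun t)) < r → m ≤ ρ w) :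
    m * eVariationOn (φ ∘ γ.toFun) K ≤ 2 * γ.lowerIntegral σ K := by
  have : NullSingletonClass γ.arclengthMeasure := ⟨hγ.arclengthMeasure_singleton⟩
  rw [eVariationOn, ENNReal.mul_iSup]
  refine iSup_le ?_
  rintro ⟨n, u, hu, huK⟩
  rw [Finset.mul_sum]
  calc ∑ i ∈ Finset.range n, m * edist ((φ ∘ γ.toFun) (u (i + 1))) ((φ ∘ γ.toFun) (u i))
      ≤ ∑ i ∈ Finset.range n, 2 * γ.lowerIntegral σ (Ioc (u i) (u (i + 1))) := by
        refine Finset.sum_le_sum fun i _ => ?_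
        have hle : u i ≤ u (i + 1) := hu i.le_succ
        have := h (Icc (u i) (u (i + 1))) ordConnected_Icc _ (right_mem_Icc.2 hle) _
          (left_mem_Icc.2 hle) m r hr fun t ht => hm t (hK.out (huK _) (huK _) ht)
        -- Domination uses both endpoints, disjointness needs half-open intervals; the difference is
        -- null since the arclength measure has no atoms.
        refine this.trans_eq ?_
        simp only [lowerIntegral]
        congr 2
        ext n
        exact setLIntegral_congr Ioc_ae_eq_Icc.symm
    _ ≤ 2 * ∑' i, γ.lowerIntegral σ (Ioc (u i) (u (i + 1))) := by
        rw [← Finset.mul_sum]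
        exact mul_le_mul_right (ENNReal.sum_le_tsum _) _
    _ ≤ 2 * γ.lowerIntegral σ K := by
        refine mul_le_mul_right (tsum_liminf_setLIntegral_le (fun n t => σ n (γ.toFun t))
          (fun i => measurableSet_Ioc) ?_ fun i => ?_) _
        · simpa using hu.pairwise_disjoint_on_Ioc_succ
        · exact Ioc_subset_Icc_self.trans (hK.out (huK _) (huK _))

/-- A Riemann-sum argument: lower semicontinuity makes ρ the increasing limit of its infima over
shrinking balls, and for each fixed radius short subarcs of the image see a nearly constant lower
bound. -/
theorem Dominates.integral_le [MeasurableSpace W] [BorelSpace W] (h : γ.Dominates φ ρ σ)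
    (hγ : γ.Rectifiable) (hβ : (γ.map φ).Rectifiable) (hρ : LowerSemicontinuous ρ) :
    (γ.map φ).integral ρ ≤ 2 * γ.lowerIntegral σ univ := by
  obtain ⟨lam, hint, hlam⟩ : ∃ lam : Measure γ.domain,
      (γ.map φ).integral ρ = ∫⁻ t, ρ (φ (γ.toFun t)) ∂lam ∧
      ∀ K : Set γ.domain, K.OrdConnected → lam K ≤ eVariationOn (φ ∘ γ.toFun) K :=
    ⟨(γ.map φ).arclengthMeasure, hβ.integral_eq hρ.measurable, fun K => hβ.arclengthMeasure_le⟩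
  rw [hint]
  simp_rw [← hρ.iSup_infBall]
  rw [lintegral_iSup]
  rotate_left
  · exact fun n => (measurable_infBall _ _).comp (φ.continuous.comp γ.continuous_toFun).measurable
  · intro n k hnk t
    refine infBall_anti ?_ _
    gcongr
  refine iSup_le fun n => ?_
  set r : ℝ := 1 / ((n : ℝ) + 1)
  have hr0 : 0 < r := by positivity
  let V : γ.domain → ℝ := (γ.map φ).arclength
  have hV : Monotone V := hβ.monotone_arclength
  -- Cutting by image arclength in steps of r / 2 gives countably many order-convex pieces. On each,
  -- an infimum over an r-ball at one point bounds ρ from below on the r / 2-balls at all the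
  -- others.
  let K : ℤ → Set γ.domain := fun k => (fun t => ⌊V t / (r / 2)⌋) ⁻¹' {k}
  have hKm : Monotone fun t => ⌊V t / (r / 2)⌋ := fun s t hst => by
    have := hV hst
    dsimp only
    gcongr
  have hK : ∀ k, (K k).OrdConnected := fun k => ordConnected_singleton.preimage_mono hKm
  have hKU : ⋃ k, K k = univ := eq_univ_of_forall fun t => mem_iUnion.2 ⟨_, rfl⟩
  have hKd : Pairwise (Function.onFun Disjoint K) := fun i j hij =>
    Disjoint.preimage _ (disjoint_singleton.2 hij)
  have hdist : ∀ k, ∀ t ∈ K k, ∀ t' ∈ K k, dist (φ (γ.toFun t)) (φ (γ.toFun t')) < r / 2 := by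
    intro k t ht t' ht'
    refine (hβ.dist_le t t').trans_lt ?_
    have h1 : |V t / (r / 2) - V t' / (r / 2)| < 1 :=
      Int.abs_sub_lt_one_of_floor_eq_floor (Eq.trans ht (Eq.symm ht'))
    rwa [← sub_div, abs_div, abs_of_pos (half_pos hr0), div_lt_one (half_pos hr0)] at h1
  let S : ℤ → ℝ≥0∞ := fun k => ⨆ t ∈ K k, infBall ρ r (φ (γ.toFun t))
  calc ∫⁻ t : γ.domain, infBall ρ r (φ (γ.toFun t)) ∂lam
      = ∫⁻ t in ⋃ k, K k, infBall ρ r (φ (γ.toFun t)) ∂lam := by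
        rw [hKU, setLIntegral_univ]
    _ ≤ ∑' k, ∫⁻ t in K k, infBall ρ r (φ (γ.toFun t)) ∂lam :=
        lintegral_iUnion_le _ _
    _ ≤ ∑' k, S k * eVariationOn (φ ∘ γ.toFun) (K k) := by
        refine ENNReal.tsum_le_tsum fun k => ?_
        calc ∫⁻ t in K k, infBall ρ r (φ (γ.toFun t)) ∂lam
            ≤ ∫⁻ t in K k, S k ∂lam :=
              setLIntegral_mono' (hK k).measurableSet fun t ht =>
                le_iSup₂ (f := fun t (_ : t ∈ K k) => infBall ρ r (φ (γ.toFun t))) t ht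
          _ = S k * lam (K k) := setLIntegral_const _ _
          _ ≤ _ := mul_le_mul_right (hlam _ (hK k)) _
    _ ≤ ∑' k, 2 * γ.lowerIntegral σ (K k) := by
        refine ENNReal.tsum_le_tsum fun k => ?_
        refine h.mul_eVariationOn_le hγ (hK k) (half_pos hr0) fun t ht w hw => ?_
        refine iSup₂_le fun t' ht' => infBall_le ?_
        have := dist_triangle w (φ (γ.toFun t)) (φ (γ.toFun t'))
        linarith [hdist k t ht t' ht']
    _ ≤ 2 * γ.lowerIntegral σ univ := by
        rw [ENNReal.tsum_mul_left]
        exact mul_le_mul_right (tsum_liminf_setLIntegral_le (fun n t => σ n (γ.toFun t))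
          (fun k => (hK k).measurableSet) hKd fun k => subset_univ _) _

/-- Admissibility says nothing about a nonrectifiable image; there the positive lower bound δ times
infinite variation forces the lower limit to be infinite. -/
theorem Dominates.one_le [MeasurableSpace Z] [BorelSpace Z] [MeasurableSpace W] [BorelSpace W]
    (h : γ.Dominates φ ρ σ) (hσ : ∀ n, Measurable (σ n)) (hγ : γ.Rectifiable)
    (hρ : LowerSemicontinuous ρ) {δ : ℝ≥0∞} (hδ : δ ≠ 0) (hδρ : ∀ w, δ ≤ ρ w)
    (hone : (γ.map φ).Rectifiable → 1 ≤ (γ.map φ).integral ρ) :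
    1 ≤ 2 * liminf (fun n => γ.integral (σ n)) atTop := by
  have e : liminf (fun n => γ.integral (σ n)) atTop = γ.lowerIntegral σ univ := by
    simp only [lowerIntegral, setLIntegral_univ]
    congr 1
    ext n
    exact hγ.integral_eq (hσ n)
  rw [e]
  by_cases hβ : (γ.map φ).Rectifiable
  · exact (hone hβ).trans (h.integral_le hγ hβ hρ)
  · have h1 := h.mul_eVariationOn_le hγ ordConnected_univ one_pos (m := δ)
      fun t _ w _ => hδρ w
    have h2 : eVariationOn (φ ∘ γ.toFun) univ = ∞ := not_lt_top_iff.1 hβ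
    rw [h2, ENNReal.mul_top hδ] at h1
    exact le_top.trans h1

end IntervalPath

/-! ### Constants and degenerate cases -/

theorem discretizationConst_ne_zero {Q H a b a' : ℝ} (hH : 0 < H) (ha : 0 < a) (hb : 0 < b)
    (ha' : 0 < a') : discretizationConst Q H a b a' ≠ 0 := by
  have h1 : 0 < ENNReal.ofReal (b / a * 6 ^ Q) := ENNReal.ofReal_pos.2 (by positivity)
  have h2 : 0 < ENNReal.ofReal (b * 2 ^ Q) := ENNReal.ofReal_pos.2 (by positivity)
  have h3 : 0 < ENNReal.ofReal (H ^ Q / a') := ENNReal.ofReal_pos.2 (by positivity)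
  exact mul_ne_zero (mul_ne_zero (ENNReal.rpow_pos h1 ENNReal.ofReal_ne_top).ne' h2.ne') h3.ne'

theorem discretizationConst_ne_top {Q H a b a' : ℝ} (hQ : 0 ≤ Q) :
    discretizationConst Q H a b a' ≠ ∞ :=
  ENNReal.mul_ne_top (ENNReal.mul_ne_top (ENNReal.rpow_ne_top_of_nonneg hQ ENNReal.ofReal_ne_top)
    ENNReal.ofReal_ne_top) ENNReal.ofReal_ne_top

/-- The constant in the distortion estimate for the modulus under weakly quasisymmetric
homeomorphisms. -/
def modulusConst (Q H a b a' : ℝ) : ℝ≥0∞ :=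
  2 ^ (Q - 1) * (2 + 2 ^ Q * 2) * (4 ^ Q * discretizationConst Q H a b a' * (2 ^ Q + 1))

theorem modulusConst_ne_zero {Q H a b a' : ℝ} (hH : 0 < H) (ha : 0 < a)
    (hb : 0 < b) (ha' : 0 < a') : modulusConst Q H a b a' ≠ 0 := by
  have h2 : (2 : ℝ≥0∞) ^ (Q - 1) ≠ 0 := (ENNReal.rpow_pos (by simp) (by simp)).ne'
  have h4 : (4 : ℝ≥0∞) ^ Q ≠ 0 := (ENNReal.rpow_pos (by simp) (by simp)).ne'
  simp [modulusConst, h2, h4, discretizationConst_ne_zero hH ha hb ha']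

theorem modulusConst_ne_top {Q H a b a' : ℝ} (hQ : 1 ≤ Q) : modulusConst Q H a b a' ≠ ∞ := by
  have hQ0 : 0 ≤ Q := by linarith
  have h (x r : ℝ) (hr : 0 ≤ r) : ENNReal.ofReal x ^ r ≠ ∞ :=
    ENNReal.rpow_ne_top_of_nonneg hr ENNReal.ofReal_ne_top
  have h1 : (2 : ℝ≥0∞) ^ (Q - 1) ≠ ∞ := ENNReal.rpow_ne_top_of_nonneg (by linarith) (by simp)
  have h2 : (2 : ℝ≥0∞) ^ Q ≠ ∞ := ENNReal.rpow_ne_top_of_nonneg hQ0 (by simp)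
  have h4 : (4 : ℝ≥0∞) ^ Q ≠ ∞ := ENNReal.rpow_ne_top_of_nonneg hQ0 (by simp)
  have h5 := discretizationConst_ne_top (H := H) (a := a) (b := b) (a' := a') hQ0
  unfold modulusConst
  finiteness

/-- A modulus of a nonempty path family in a space with at most one point is infinite. -/
theorem pathModulus_eq_top_of_subsingleton {Z : Type*} [MetricSpace Z] [Subsingleton Z]
    [MeasurableSpace Z] [BorelSpace Z] (μ : Measure Z) (Q : ℝ) {Γ : Set (IntervalPath Z)}
    (hΓ : Γ.Nonempty) : pathModulus μ Q Γ = ∞ := by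
  refine top_le_iff.1 (le_iInf₂ fun ρ hρ => ?_)
  obtain ⟨γ, hγ⟩ := hΓ
  exfalso
  have h0 : eVariationOn γ.toFun univ = 0 := eVariationOn.constant_on subsingleton_of_subsingleton
  have hr : γ.Rectifiable := by
    simp [IntervalPath.Rectifiable, IntervalPath.length, h0]
  have h1 := hρ.2 γ hγ hr
  have h2 : γ.arclengthMeasure = 0 :=
    Measure.measure_univ_eq_zero.1 (nonpos_iff_eq_zero.1
      ((hr.arclengthMeasure_le ordConnected_univ).trans h0.le))
  rw [hr.integral_eq hρ.1, h2, lintegral_zero_measure] at h1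
  exact not_lt_of_ge h1 one_pos

theorem pathModulus_empty {Z : Type*} [MetricSpace Z] [MeasurableSpace Z] (μ : Measure Z) {Q : ℝ}
    (hQ : 0 < Q) : pathModulus μ Q ∅ = 0 := by
  have : AdmissibleFor (fun _ : Z => 0) (∅ : Set (IntervalPath Z)) :=
    ⟨measurable_const, fun γ hγ => absurd hγ (notMem_empty γ)⟩
  simpa [hQ] using this.pathModulus_le (μ := μ) (Q := Q)

/-! ### The one-sided modulus inequality -/

section Main

variable {Z W : Type*} [MetricSpace Z] [CompactSpace Z] [MeasurableSpace Z] [BorelSpace Z]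
  [MetricSpace W] [CompactSpace W] [MeasurableSpace W] [BorelSpace W]
  {μ : Measure Z} {ν : Measure W} {Q H a b a' b' : ℝ}

theorem AhlforsRegular.isFiniteMeasure [Nontrivial W] (hν : AhlforsRegular ν Q a' b') :
    IsFiniteMeasure ν := by
  have hd : 0 < Metric.diam (univ : Set W) := by
    obtain ⟨x, y, hxy⟩ := exists_pair_ne W
    exact (dist_pos.2 hxy).trans_le (Metric.dist_le_diam_of_mem isCompact_univ.isBounded
      (mem_univ x) (mem_univ y))
  have : IsLocallyFiniteMeasure ν := ⟨fun w => ⟨_, Metric.ball_mem_nhds w hd,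
    (hν w _ hd le_rfl).2.trans_lt ENNReal.ofReal_lt_top⟩⟩
  infer_instance

/-- A density can be replaced by a lower semicontinuous one which is bounded away from zero. -/
theorem exists_lowerSemicontinuous_ge [IsFiniteMeasure ν] (hQ : 1 < Q) {ρ : W → ℝ≥0∞}
    (hρ : Measurable ρ) {M : ℝ≥0∞} (hM : M ≠ 0) (hρM : ∫⁻ w, ρ w ^ Q ∂ν ≤ M) :
    ∃ ρ' : W → ℝ≥0∞, LowerSemicontinuous ρ' ∧ ρ ≤ ρ' ∧ (∃ δ, δ ≠ 0 ∧ ∀ w, δ ≤ ρ' w) ∧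
      ∫⁻ w, ρ' w ^ Q ∂ν ≤ (2 ^ Q + 1) * M := by
  have hQ0 : 0 < Q := by linarith
  obtain ⟨δ, hδ, hδM⟩ : ∃ δ : ℝ≥0, 0 < δ ∧ (δ : ℝ≥0∞) ^ Q * ν univ ≤ M := by
    have ht : Tendsto (fun δ : ℝ≥0 => (δ : ℝ≥0∞) ^ Q * ν univ) (𝓝[>] 0) (𝓝 0) := by
      have h1 : Tendsto (fun δ : ℝ≥0 => (δ : ℝ≥0∞) ^ Q) (𝓝 0) (𝓝 0) := by
        have : Continuous fun δ : ℝ≥0 => (δ : ℝ≥0∞) ^ Q :=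
          ENNReal.continuous_rpow_const.comp ENNReal.continuous_coe
        simpa [ENNReal.zero_rpow_of_pos hQ0] using this.tendsto 0
      have := ENNReal.Tendsto.mul_const (b := ν univ) h1 (Or.inr (measure_ne_top _ _))
      rw [zero_mul] at this
      exact this.mono_left nhdsWithin_le_nhds
    obtain ⟨δ, h3, h4⟩ :=
      ((ht.eventually_lt_const (pos_iff_ne_zero.2 hM)).and self_mem_nhdsWithin).exists
    exact ⟨δ, h4, h3.le⟩
  -- Vitali–Carathéodory is applied to the Q-th power, with error M, so that the Q-th root of g has
  -- controlled energy.
  obtain ⟨g, hg, hgl, hgi⟩ := exists_le_lowerSemicontinuous_lintegral_ge ν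
    (fun w => (ρ w + δ) ^ Q) ((hρ.add_const _).pow_const Q) hM
  have hle : ∀ w, ρ w + δ ≤ g w ^ Q⁻¹ := fun w => by
    rw [ENNReal.le_rpow_inv_iff hQ0]
    exact hg w
  refine ⟨fun w => g w ^ Q⁻¹, ?_, fun w => le_self_add.trans (hle w),
    ⟨δ, by simpa using hδ.ne', fun w => le_add_self.trans (hle w)⟩, ?_⟩
  · exact (ENNReal.continuous_rpow_const (y := Q⁻¹)).comp_lowerSemicontinuous hgl
      (ENNReal.monotone_rpow_of_nonneg (by positivity))
  · simp_rw [ENNReal.rpow_inv_rpow hQ0.ne']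
    refine hgi.trans ?_
    calc ∫⁻ w, (ρ w + δ) ^ Q ∂ν + M
        ≤ ∫⁻ w, 2 ^ (Q - 1) * (ρ w ^ Q + δ ^ Q) ∂ν + M := by
          refine add_le_add (lintegral_mono fun w => ?_) le_rfl
          exact ENNReal.rpow_add_le_mul_rpow_add_rpow _ _ hQ.le
      _ = 2 ^ (Q - 1) * (∫⁻ w, ρ w ^ Q ∂ν + δ ^ Q * ν univ) + M := by
          rw [lintegral_const_mul' _ _ (ENNReal.rpow_ne_top_of_nonneg (by linarith) (by simp)),
            lintegral_add_right _ measurable_const, lintegral_const]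
      _ ≤ 2 ^ (Q - 1) * (M + M) + M := by gcongr
      _ = (2 ^ Q + 1) * M := by
          have : (2 : ℝ≥0∞) ^ Q = 2 ^ (Q - 1) * 2 := by
            conv_lhs => rw [← sub_add_cancel Q 1, ENNReal.rpow_add _ _ (by simp) (by simp),
              ENNReal.rpow_one]
          rw [this]
          ring

/-- Pullbacks of lower semicontinuous densities under weakly quasisymmetric homeomorphisms are
asymptotically dominated by densities of controlled energy. -/
theorem exists_dominating_sequence [Nontrivial Z] (hQ : 0 < Q) (hH : 1 ≤ H)
    (ha : 0 < a) (hb : 0 < b) (ha' : 0 < a') (hμ : AhlforsRegular μ Q a b)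
    (hν : AhlforsRegular ν Q a' b') (φ : Z ≃ₜ W) (hφ : WeakQuasisymmetric H φ)
    (ρ : W → ℝ≥0∞) :
    ∃ σ : ℕ → Z → ℝ≥0∞, (∀ n, Measurable (σ n)) ∧
      (∀ n, ∫⁻ z, σ n z ^ Q ∂μ ≤ discretizationConst Q H a b a' * ∫⁻ w, ρ w ^ Q ∂ν) ∧
      ∀ γ : IntervalPath Z, γ.Rectifiable → γ.Dominates (φ : C(Z, W)) ρ σ := by
  have hd : 0 < Metric.diam (univ : Set Z) := by
    obtain ⟨x, y, hxy⟩ := exists_pair_ne Z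
    exact (dist_pos.2 hxy).trans_le (Metric.dist_le_diam_of_mem isCompact_univ.isBounded
      (mem_univ x) (mem_univ y))
  set D := Metric.diam (univ : Set Z)
  -- The factor D / 3 ensures 3 ε ≤ diam Z, the range in which regularity of μ is used.
  let ε : ℕ → ℝ := fun n => D / 3 * (1 / ((n : ℝ) + 1))
  have hε : ∀ n, 0 < ε n := fun n => by positivity
  have hεD : ∀ n, 3 * ε n ≤ D := fun n => by
    have h1 : 1 / ((n : ℝ) + 1) ≤ 1 := by
      rw [div_le_one (by positivity)]
      linarith [(Nat.cast_nonneg n : (0 : ℝ) ≤ n)]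
    have : 3 * ε n = D * (1 / ((n : ℝ) + 1)) := by simp only [ε]; ring
    rw [this]
    exact mul_le_of_le_one_right hd.le h1
  have hεt : Tendsto (fun n => 2 * ε n) atTop (𝓝 0) := by
    have := (tendsto_one_div_add_atTop_nhds_zero_nat (𝕜 := ℝ)).const_mul (2 * (D / 3))
    rw [mul_zero] at this
    exact this.congr fun n => by simp only [ε]; ring
  choose σ hσm hσe hσl using fun n =>
    exists_discretization hQ hH ha hb ha' hμ hν φ hφ ρ (hε n) (hεD n)
  refine ⟨σ, hσm, hσe, fun γ hγ K hK x hx y hy m r hr hm => ?_⟩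
  rcases eq_or_ne (γ.toFun x) (γ.toFun y) with hxy | hxy
  · simp [hxy]
  obtain ⟨δ, hδ, hφδ⟩ := Metric.uniformContinuous_iff.1
    (CompactSpace.uniformContinuous_of_continuous φ.continuous) r hr
  have key : 2⁻¹ * (m * edist (φ (γ.toFun x)) (φ (γ.toFun y))) ≤ γ.lowerIntegral σ K := by
    refine le_liminf_of_le (by isBoundedDefault) ?_
    filter_upwards [hεt.eventually_lt_const hδ, hεt.eventually_lt_const (dist_pos.2 hxy)]
      with n hn1 hn2
    rw [ENNReal.inv_mul_le_iff (by simp) (by simp)]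
    exact hσl n γ hγ K hK x hx y hy hn2.le m fun t ht z hz => hm t ht _ (hφδ (hz.trans hn1))
  rwa [ENNReal.inv_mul_le_iff (by simp) (by simp)] at key

/-- Weakly quasisymmetric homeomorphisms between Ahlfors regular spaces do not decrease the
modulus by more than a constant factor. -/
theorem pathModulus_le_modulusConst_mul (hQ : 1 < Q) (hH : 1 ≤ H) (ha : 0 < a) (hb : 0 < b)
    (ha' : 0 < a') (hμ : AhlforsRegular μ Q a b) (hν : AhlforsRegular ν Q a' b')
    (φ : Z ≃ₜ W) (hφ : WeakQuasisymmetric H φ) (Γ : Set (IntervalPath Z)) :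
    pathModulus μ Q Γ ≤
      modulusConst Q H a b a' * pathModulus ν Q (IntervalPath.map (φ : C(Z, W)) '' Γ) := by
  have hQ0 : 0 < Q := by linarith
  have hC0 := modulusConst_ne_zero (Q := Q) (by linarith : 0 < H) ha hb ha'
  have hCt := modulusConst_ne_top (H := H) (a := a) (b := b) (a' := a') hQ.le
  rcases subsingleton_or_nontrivial Z with hZ | hZ
  · have : Subsingleton W := φ.symm.injective.subsingleton
    rcases Γ.eq_empty_or_nonempty with rfl | hΓ
    · simp [pathModulus_empty μ hQ0]
    · rw [pathModulus_eq_top_of_subsingleton ν Q (hΓ.image _), ENNReal.mul_top hC0]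
      exact le_top
  have : Nontrivial W := φ.symm.surjective.nontrivial
  have : IsFiniteMeasure ν := hν.isFiniteMeasure
  suffices hsuff : ∀ M, pathModulus ν Q (IntervalPath.map (φ : C(Z, W)) '' Γ) < M → M ≠ ∞ →
      pathModulus μ Q Γ ≤ modulusConst Q H a b a' * M by
    rw [mul_comm, ← ENNReal.div_le_iff_le_mul (Or.inl hC0) (Or.inl hCt)]
    refine le_of_forall_gt fun M hM => ?_
    obtain ⟨M', h1, h2⟩ := exists_between hM
    refine lt_of_le_of_lt ?_ h2
    rw [ENNReal.div_le_iff_le_mul (Or.inl hC0) (Or.inl hCt), mul_comm]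
    exact hsuff M' h1 (h2.trans_le le_top).ne
  intro M hM hMt
  have hM0 : M ≠ 0 := (pos_of_gt hM).ne'
  obtain ⟨ρ₀, hρ₀, hρ₀M⟩ := exists_admissibleFor_lt hM
  obtain ⟨ρ, hρ, hρ₀ρ, ⟨δ, hδ, hδρ⟩, hρM⟩ :=
    exists_lowerSemicontinuous_ge hQ hρ₀.1 hM0 hρ₀M.le
  have hadm := hρ₀.mono hρ.measurable hρ₀ρ
  obtain ⟨σ, hσm, hσe, hσd⟩ :=
    exists_dominating_sequence hQ0 hH ha hb ha' hμ hν φ hφ ρ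
  -- The lower limit is at least 1/2, and the smaller threshold 1/4 is then exceeded from some index
  -- on. Hence 4 * σ k is admissible for Γ' k.
  let Γ' : ℕ → Set (IntervalPath Z) := fun k =>
    {γ ∈ Γ | γ.Rectifiable → ∀ n ≥ k, 4⁻¹ ≤ γ.integral (σ n)}
  have hΓ' : Monotone Γ' := fun k l hkl γ hγ => ⟨hγ.1, fun hr n hn => hγ.2 hr n (hkl.trans hn)⟩
  have hΓU : Γ ⊆ ⋃ k, Γ' k := by
    intro γ hγ
    by_cases hr : γ.Rectifiable
    · have h1 := (hσd γ hr).one_le hσm hr hρ hδ hδρ (hadm.2 _ (mem_image_of_mem _ hγ))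
      have h2 : (2⁻¹ : ℝ≥0∞) ≤ liminf (fun n => γ.integral (σ n)) atTop := by
        rw [← mul_one (2⁻¹ : ℝ≥0∞), ENNReal.inv_mul_le_iff (by simp) (by simp)]
        exact h1
      have h3 : (4⁻¹ : ℝ≥0∞) < 2⁻¹ := ENNReal.inv_lt_inv.2 (by norm_num)
      obtain ⟨k, hk⟩ := eventually_atTop.1
        (eventually_lt_of_lt_liminf (h3.trans_le h2) (by isBoundedDefault))
      exact mem_iUnion.2 ⟨k, hγ, fun _ n hn => (hk n hn).le⟩
    · exact mem_iUnion.2 ⟨0, hγ, fun h => absurd h hr⟩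
  set M' := 4 ^ Q * discretizationConst Q H a b a' * (2 ^ Q + 1) * M with hM'
  have h4 : (4 : ℝ≥0∞) ^ Q ≠ 0 := (ENNReal.rpow_pos (by simp) (by simp)).ne'
  have h4t : (4 : ℝ≥0∞) ^ Q ≠ ∞ := ENNReal.rpow_ne_top_of_nonneg hQ0.le (by simp)
  have h2t : (2 : ℝ≥0∞) ^ Q ≠ ∞ := ENNReal.rpow_ne_top_of_nonneg hQ0.le (by simp)
  have hD0 := discretizationConst_ne_zero (Q := Q) (by linarith : 0 < H) ha hb ha'
  have hDt := discretizationConst_ne_top (H := H) (a := a) (b := b) (a' := a') hQ0.le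
  have hM'0 : M' ≠ 0 := by simp [hM', h4, hD0, hM0]
  have hM't : M' ≠ ∞ := by rw [hM']; finiteness
  have hmod : ∀ k, pathModulus μ Q (Γ' k) ≤ M' := by
    intro k
    have h1 : AdmissibleFor (fun z => 4 * σ k z) (Γ' k) := by
      refine ⟨(hσm k).const_mul _, fun γ hγ hr => ?_⟩
      calc (1 : ℝ≥0∞) = 4 * 4⁻¹ := (ENNReal.mul_inv_cancel (by simp) (by simp)).symm
        _ ≤ 4 * γ.integral (σ k) := by
            gcongr
            exact hγ.2 hr k le_rfl
        _ = _ := (lintegral_const_mul' _ _ (by simp)).symm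
    refine h1.pathModulus_le.trans ?_
    simp_rw [ENNReal.mul_rpow_of_nonneg _ _ hQ0.le]
    rw [lintegral_const_mul' _ _ h4t, hM', mul_assoc, mul_assoc]
    gcongr
    refine (hσe k).trans ?_
    gcongr
  refine (pathModulus_mono hΓU).trans ((pathModulus_iUnion_le hQ hΓ' hM'0 hM't hmod).trans_eq ?_)
  rw [hM', modulusConst]
  ring

end Main

/-! ### From quasisymmetry to both inequalities -/

theorem IsQuasisymmetric.weakQuasisymmetric {Z W : Type*} [MetricSpace Z] [MetricSpace W]
    {η : ℝ≥0 → ℝ≥0} {φ : Z → W} (h : IsQuasisymmetric η φ) :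
    WeakQuasisymmetric (max (η 2) 1) φ := fun z z' z'' hz =>
  (h z z' z'' 2 (by simpa using hz)).trans
    (mul_le_mul_of_nonneg_right (le_max_left _ _) dist_nonneg)

/-- If the inverse images violated the bound, quasisymmetry at t would give d(w, w'') ≤ η(t) d(w,
w') with η(t) < 1/2, contradicting d(w, w') ≤ 2 d(w, w'') unless w = w'. -/
theorem IsQuasisymmetric.weakQuasisymmetric_symm {Z W : Type*} [MetricSpace Z] [MetricSpace W]
    {η : ℝ≥0 → ℝ≥0} {φ : Z ≃ₜ W} (h : IsQuasisymmetric η φ) {t : ℝ≥0} (ht : t ≠ 0)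
    (hηt : η t < 1 / 2) : WeakQuasisymmetric (max (t : ℝ)⁻¹ 1) φ.symm := by
  intro w w' w'' hw
  have ht0 : (0 : ℝ) < t := by exact_mod_cast pos_iff_ne_zero.2 ht
  refine le_trans ?_ (mul_le_mul_of_nonneg_right (le_max_left _ _) dist_nonneg)
  by_contra! hlt
  rw [inv_mul_lt_iff₀ ht0] at hlt
  have h1 := h (φ.symm w) (φ.symm w'') (φ.symm w') t hlt.le
  simp only [Homeomorph.apply_symm_apply] at h1
  have h2 : (η t : ℝ) < 1 / 2 := by exact_mod_cast hηt
  have h3 : dist w w' = 0 := by nlinarith [dist_nonneg (x := w) (y := w')]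
  rw [dist_eq_zero.1 h3, dist_self, mul_zero] at hlt
  exact hlt.not_ge dist_nonneg

theorem IntervalPath.image_map_symm_image_map {Z W : Type*} [MetricSpace Z] [MetricSpace W]
    (φ : Z ≃ₜ W) (Γ : Set (IntervalPath Z)) :
    IntervalPath.map (φ.symm : C(W, Z)) '' (IntervalPath.map (φ : C(Z, W)) '' Γ) = Γ := by
  have h : ∀ γ : IntervalPath Z, (γ.map (φ : C(Z, W))).map (φ.symm : C(W, Z)) = γ := by
    intro γ
    have : (φ.symm : C(W, Z)) ∘ (φ : C(Z, W)) ∘ γ.toFun = γ.toFun := by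
      ext t
      simp
    simp only [IntervalPath.map, this]
  simp [image_image, h]

end

theorem mainTheorem6 (Q : ℝ) (hQ : 1 < Q) (η : ℝ≥0 ≃ₜ ℝ≥0)
    (aZ bZ aW bW : ℝ) (haZ : 0 < aZ) (hbZ : 0 < bZ) (haW : 0 < aW) (hbW : 0 < bW) :
    ∃ c C : ℝ≥0, 0 < c ∧ 0 < C ∧
      ∀ (Z : Type*) [MetricSpace Z] [CompactSpace Z] [ConnectedSpace Z]
        [MeasurableSpace Z] [BorelSpace Z] (μ : Measure Z)
        (W : Type*) [MetricSpace W] [CompactSpace W] [ConnectedSpace W]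
        [MeasurableSpace W] [BorelSpace W] (ν : Measure W),
        AhlforsRegular μ Q aZ bZ → AhlforsRegular ν Q aW bW →
        ∀ φ : Z ≃ₜ W, IsQuasisymmetric η φ →
          ∀ Γ : Set (IntervalPath Z),
            c * pathModulus μ Q Γ ≤ pathModulus ν Q (IntervalPath.map (φ : C(Z, W)) '' Γ) ∧
            pathModulus ν Q (IntervalPath.map (φ : C(Z, W)) '' Γ) ≤ C * pathModulus μ Q Γ := by
  obtain ⟨t, ht, hηt⟩ : ∃ t : ℝ≥0, t ≠ 0 ∧ η t < 1 / 2 := by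
    -- At most one of the preimages of 1/4 and 1/3 is zero, so a nonzero t with η t < 1/2 exists by
    -- bijectivity alone.
    by_cases h : η.symm (1 / 4) = 0
    · refine ⟨η.symm (1 / 3), fun h' => ?_, ?_⟩
      · have := η.symm.injective (h.trans h'.symm)
        norm_num [div_eq_div_iff] at this
      · rw [η.apply_symm_apply, one_div, one_div]
        exact (inv_lt_inv₀ (by norm_num) (by norm_num)).2 (by norm_num)
    · refine ⟨_, h, ?_⟩
      rw [η.apply_symm_apply, one_div, one_div]
      exact (inv_lt_inv₀ (by norm_num) (by norm_num)).2 (by norm_num)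
  set C₁ := modulusConst Q (max (η 2) 1) aZ bZ aW
  set C₂ := modulusConst Q (max (t : ℝ)⁻¹ 1) aW bW aZ
  have h10 : C₁ ≠ 0 := modulusConst_ne_zero (by positivity) haZ hbZ haW
  have h1t : C₁ ≠ ∞ := modulusConst_ne_top hQ.le
  have h20 : C₂ ≠ 0 := modulusConst_ne_zero (by positivity) haW hbW haZ
  have h2t : C₂ ≠ ∞ := modulusConst_ne_top hQ.le
  refine ⟨C₁.toNNReal⁻¹, C₂.toNNReal, inv_pos.2 (ENNReal.toNNReal_pos h10 h1t),
    ENNReal.toNNReal_pos h20 h2t, ?_⟩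
  intro Z _ _ _ _ _ μ W _ _ _ _ _ ν hμ hν φ hφ Γ
  constructor
  · rw [ENNReal.coe_inv (ENNReal.toNNReal_pos h10 h1t).ne', ENNReal.coe_toNNReal h1t,
      ENNReal.inv_mul_le_iff h10 h1t]
    exact pathModulus_le_modulusConst_mul hQ (le_max_right _ _) haZ hbZ haW hμ hν φ
      hφ.weakQuasisymmetric Γ
  · rw [ENNReal.coe_toNNReal h2t]
    have := pathModulus_le_modulusConst_mul hQ (le_max_right _ _) haW hbW haZ hν hμ φ.symm
      (hφ.weakQuasisymmetric_symm ht hηt) (IntervalPath.map (φ : C(Z, W)) '' Γ)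
    rwa [IntervalPath.image_map_symm_image_map] at this
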